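/- **Setting.** In the impartial octal game $\mathbf{0.33}$ (normal play) on a finite graph, a move removes one vertex, or two adjacent vertices, of a connected component without disconnecting that component (removing the whole component is allowed). The Grundy value $\mathcal G(J)$ of a position $J$ is the least nonnegative integer that is not the Grundy value of an option of $J$, and $J_1\equiv J_2$ means that the disjoint sum $J_1+J_2$ is a win for the second player. Let $\oplus$ be the nim-sum (bitwise XOR). A *subdivided star* is either the empty graph $\emptyset$ or $S_{\ell_1,\dots,\ell_k}$ ($k\ge 0$, all $\ell_i\ge 1$), the tree made of a central vertex with $k$ paths attached to it, the $i$-th path having $\ell_i$ vertices; it is considered together with its central vertex. In particular $P_1$ is the star with $k=0$ and $P_2=S_1$. For subdivided stars $S,S'$, the bistar $S\!-\!S'$ is obtained from the disjoint union of $S$ and $S'$ by joining the two central vertices by an edge; if one of them is empty it is the other one. Write $S\sim_1 S'$ if $S\!-\!\hat S\equiv S'\!-\!\hat S$ for every subdivided star $\hat S$ (including $\emptyset$). The *reduction* $\bar S$ of a subdivided star $S$ is obtained by replacing each path length $\ell_i$ by $\ell_i \bmod 3$ and deleting the paths whose length becomes $0$ (and $\bar\emptyset=\emptyset$). Define the following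 sets of subdivided stars: * $\mathcal C_1^*$: those $S$ with $\bar S\in\{P_1,S_{2,1},S_{2,2,2}\}$; * $\mathcal C_2^*$: those $S$ with $\bar S\in\{P_2,S_{2,2}\}$; * $\mathcal C_i^{\Box}$ for $i\in\{2,3\}$: those $S$ with $\mathcal G(S)=i$ such that $\bar S$ has exactly one or exactly three paths of length $2$; * $\mathcal C_i$ for $i\in\{0,1,2,3\}$: those $S$ with $\mathcal G(S)=i$ that belong to none of $\mathcal C_1^*,\mathcal C_2^*,\mathcal C_2^\Box,\mathcal C_3^\Box$. **Theorem.** The relation $\sim_1$ is an equivalence relation on subdivided stars, and its equivalence classes are exactly the eight pairwise distinct sets $\mathcal C_0,\mathcal C_1,\mathcal C_1^*,\mathcal C_2,\mathcal C_2^*,\mathcal C_2^\Box,\mathcal C_3,\mathcal C_3^\Box$. Moreover, for all subdivided stars $S,S'$, $$\mathcal G(S\!-\!S')=\begin{cases} 2 & \text{if } S,S'\in\mathcal C_1^*,\\ 0 & \text{if one of } S,S' \text{ is in } \mathcal C_1^* \text{ and the other in } \mathcal C_2^*,\\ 1 & \text{if } S,S'\in\mathcal C_2^*,\\ 1 & \text{if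 one of } S,S' \text{ is in } \mathcal C_2^* \text{ and the other in } \mathcal C_2^\Box,\\ 0 & \text{if one of } S,S' \text{ is in } \mathcal C_2^* \text{ and the other in } \mathcal C_3^\Box,\\ \mathcal G(S)\oplus\mathcal G(S') & \text{otherwise.} \end{cases}$$ -/

import Mathlib

/-! ### Impartial games in normal play -/

/-- A (finite) impartial game on a type of positions `P`; `Opt J J'` says that `J'` is an option
of `J`. -/
structure ImpartialGame (P : Type) where
  Opt : P → P → Prop
  wf : WellFounded (fun J' J => Opt J J')
  finite_opt : ∀ J, {J' | Opt J J'}.Finite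

namespace ImpartialGame

variable {P Q : Type}

/-- `J` is a `𝒫`-position (the previous player wins): no option of `J` is a `𝒫`-position. -/
def IsPPosition (g : ImpartialGame P) : P → Prop :=
  g.wf.fix fun J ih => ∀ J' (h : g.Opt J J'), ¬ ih J' h

/-- The Grundy value of a position: the least natural number which is not the Grundy value of an
option. -/
noncomputable def grundy (g : ImpartialGame P) : P → ℕ :=
  g.wf.fix fun J ih => sInf {n | ∀ J' (h : g.Opt J J'), ih J' h ≠ n}

theorem isPPosition_iff (g : ImpartialGame P) (J : P) :
    g.IsPPosition J ↔ ∀ J', g.Opt J J' → ¬ g.IsPPosition J' := by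
  unfold IsPPosition
  rw [g.wf.fix_eq]

theorem grundy_eq (g : ImpartialGame P) (J : P) :
    g.grundy J = sInf {n | ∀ J', g.Opt J J' → g.grundy J' ≠ n} := by
  unfold grundy
  rw [g.wf.fix_eq]

/-- The disjoint sum of two games: a move is a move in exactly one of the two components. -/
def sum (g : ImpartialGame P) (h : ImpartialGame Q) : ImpartialGame (P × Q) where
  Opt J J' := (g.Opt J.1 J'.1 ∧ J'.2 = J.2) ∨ (J'.1 = J.1 ∧ h.Opt J.2 J'.2)
  wf := by
    refine Subrelation.wf ?_ (g.wf.prod_gameAdd h.wf)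
    rintro ⟨a', b'⟩ ⟨a, b⟩ (⟨h1, h2⟩ | ⟨h1, h2⟩)
    · cases h2
      exact Prod.GameAdd.fst h1
    · cases h1
      exact Prod.GameAdd.snd h2
  finite_opt := by
    rintro ⟨a, b⟩
    refine (((g.finite_opt a).prod (Set.finite_singleton b)).union
      ((Set.finite_singleton a).prod (h.finite_opt b))).subset ?_
    rintro ⟨a', b'⟩ (⟨h1, h2⟩ | ⟨h1, h2⟩)
    · exact Or.inl ⟨h1, h2⟩
    · exact Or.inr ⟨h1, h2⟩

/-- The equivalence `J ≡ K` of two game positions: `J + K` is a `𝒫`-position. -/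
def Equivalent (g : ImpartialGame P) (J : P) (h : ImpartialGame Q) (K : Q) : Prop :=
  (g.sum h).IsPPosition (J, K)

end ImpartialGame

/-! ### Octal games on graphs -/

section Octal

variable {V : Type} [DecidableEq V]

/-- The vertices of `G[A]` in the connected component(s) of `G[A]` meeting `X`. -/
def componentOf (G : SimpleGraph V) (A X : Finset V) : Set V :=
  {v | ∃ x ∈ X, ∃ (hx : x ∈ (A : Set V)) (hv : v ∈ (A : Set V)),
    (G.induce (A : Set V)).Reachable ⟨x, hx⟩ ⟨v, hv⟩}

/-- In the octal game `0.u₁u₂…` played on the graph `G[A]`, it is legal to remove the set `X` of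
vertices: `X` induces a connected graph, and, `H` being the component of `G[A]` containing `X` and
`u_i = b₁ + 2 b₂ + 4 b₃` with `i = |X|`, either `X = H` and `b₁ = 1`, or `H \ X` is nonempty and
connected and `b₂ = 1`, or `H \ X` is disconnected and `b₃ = 1`. -/
def OctalLegal (u : ℕ → Fin 8) (G : SimpleGraph V) (A X : Finset V) : Prop :=
  X ⊆ A ∧ (G.induce (X : Set V)).Connected ∧
    ((componentOf G A X \ X = ∅ ∧ (u X.card).val.testBit 0 = true) ∨
     ((G.induce (componentOf G A X \ X)).Connected ∧ (u X.card).val.testBit 1 = true) ∨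
     ((componentOf G A X \ X).Nonempty ∧ ¬ (G.induce (componentOf G A X \ X)).Connected ∧
        (u X.card).val.testBit 2 = true))

/-- The octal game with code `u` on the graph `G`. The finite set `A` of remaining vertices stands
for the position `G[A]`. -/
def octalGame (u : ℕ → Fin 8) (G : SimpleGraph V) : ImpartialGame (Finset V) where
  Opt A B := ∃ X, OctalLegal u G A X ∧ B = A \ X
  wf := by
    refine Subrelation.wf ?_ (Finset.isWellFounded_ssubset (α := V)).wf
    rintro B A ⟨X, ⟨hXA, hX, -⟩, rfl⟩
    obtain ⟨⟨x, hx⟩⟩ := hX.nonempty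
    have hx' : x ∈ X := hx
    exact Finset.sdiff_ssubset hXA ⟨x, hx'⟩
  finite_opt := by
    intro A
    refine (A.powerset.finite_toSet).subset ?_
    rintro B ⟨X, -, rfl⟩
    simp

/-- The code of the octal game `0.33`. -/
def code033 : ℕ → Fin 8 := fun i => if i = 1 ∨ i = 2 then 3 else 0

/-- The Grundy value of the game `0.33` on a finite graph. -/
noncomputable def grundy033 [Fintype V] (G : SimpleGraph V) : ℕ :=
  (octalGame code033 G).grundy Finset.univ

end Octal

/-- `G ≡ H` for the game `0.33` played on two finite graphs. -/
def Equivalent033 {V W : Type} [DecidableEq V] [Fintype V] [DecidableEq W] [Fintype W]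
    (G : SimpleGraph V) (H : SimpleGraph W) : Prop :=
  (octalGame code033 G).Equivalent Finset.univ (octalGame code033 H) Finset.univ

/-! ### Subdivided stars and bistars -/

/-- The edges of the spider with legs of lengths `len i`, oriented away from the centre `none`;
`some ⟨i, j⟩` is the vertex at distance `j + 1` from the centre on the leg `i`. -/
inductive SpiderEdge {ι : Type} (len : ι → ℕ+) :
    Option (Σ i, Fin (len i)) → Option (Σ i, Fin (len i)) → Prop
  | first (i : ι) (j : Fin (len i)) (hj : j.val = 0) : SpiderEdge len none (some ⟨i, j⟩)
  | next (i : ι) (j k : Fin (len i)) (hjk : k.val = j.val + 1) :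
      SpiderEdge len (some ⟨i, j⟩) (some ⟨i, k⟩)

/-- The star with one edge for each `i : ι`, in which the edge `i` is replaced with a path having
`len i` vertices besides the centre. -/
def spider {ι : Type} (len : ι → ℕ+) : SimpleGraph (Option (Σ i, Fin (len i))) :=
  SimpleGraph.fromRel (SpiderEdge len)

/-- A subdivided star: either the empty graph, or `S_{ℓ₁,…,ℓₖ}` with `k ≥ 0` and all `ℓᵢ ≥ 1`,
given by the multiset of the `ℓᵢ`. In particular `star 0` is `P₁` and `star {1}` is `P₂`. -/
inductive SubdividedStar : Type
  | empty : SubdividedStar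
  | star (arms : Multiset ℕ+) : SubdividedStar

namespace SubdividedStar

/-- The vertices of a star. The paths of `S_{ℓ₁,…,ℓₖ}` are indexed by the pairs `(ℓ, i)` where `i`
is less than the multiplicity of `ℓ`. -/
abbrev Vertex : SubdividedStar → Type
  | empty => Empty
  | star arms => Option (Σ p : arms.toEnumFinset, Fin p.1.1)

instance (S : SubdividedStar) : DecidableEq S.Vertex :=
  match S with
  | empty => inferInstanceAs (DecidableEq Empty)
  | star arms => inferInstanceAs (DecidableEq (Option (Σ p : arms.toEnumFinset, Fin p.1.1)))

instance (S : SubdividedStar) : Fintype S.Vertex :=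
  match S with
  | empty => inferInstanceAs (Fintype Empty)
  | star arms => inferInstanceAs (Fintype (Option (Σ p : arms.toEnumFinset, Fin p.1.1)))

/-- The underlying graph of a subdivided star. -/
def graph : (S : SubdividedStar) → SimpleGraph S.Vertex
  | empty => (⊥ : SimpleGraph Empty)
  | star arms => spider (fun p : arms.toEnumFinset => p.1.1)

/-- The vertex is the central vertex of the star (the empty graph has none). -/
def IsCenter : (S : SubdividedStar) → S.Vertex → Prop
  | empty => fun _ => False
  | star _ => fun v => v = none

/-- The bistar `S–S'` with a middle path of length 1: the disjoint union of `S` and `S'` with an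
edge joining the two central vertices; it is just the other star if one of them is empty. -/
def bistar (S S' : SubdividedStar) : SimpleGraph (S.Vertex ⊕ S'.Vertex) :=
  (S.graph ⊕g S'.graph) ⊔
    SimpleGraph.fromRel (fun x y => ∃ c c', S.IsCenter c ∧ S'.IsCenter c' ∧
      x = Sum.inl c ∧ y = Sum.inr c')

/-- The Grundy value of the game `0.33` on a subdivided star. -/
noncomputable def grundy (S : SubdividedStar) : ℕ := grundy033 S.graph

/-- `S ∼₁ S'`: for every subdivided star `Ŝ`, `S–Ŝ ≡ S'–Ŝ`. -/
def Sim1 (S S' : SubdividedStar) : Prop :=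
  ∀ T : SubdividedStar, Equivalent033 (bistar S T) (bistar S' T)

/-- Reduction of the path lengths modulo 3: paths of length `0` modulo 3 disappear. -/
def reduce : SubdividedStar → SubdividedStar
  | empty => empty
  | star arms => star (arms.filterMap fun l =>
      if h : 0 < (l : ℕ) % 3 then some ⟨(l : ℕ) % 3, h⟩ else none)

/-- The number of paths of length exactly 2 of a star. -/
def twos : SubdividedStar → ℕ
  | empty => 0
  | star arms => arms.count 2

end SubdividedStar

/-! ### The eight classes -/

/-- Names of the eight classes `𝒞₀, 𝒞₁, 𝒞₁*, 𝒞₂, 𝒞₂*, 𝒞₂□, 𝒞₃, 𝒞₃□`. -/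
inductive StarClass : Type
  | c0 | c1 | c1s | c2 | c2s | c2b | c3 | c3b

namespace StarClass

/-- `𝒞₁* = {P₁, S_{2,1}, S_{2,2,2}}` (after reduction of the paths modulo 3). -/
def set1s : Set SubdividedStar :=
  {S | S.reduce ∈ ({.star 0, .star {2, 1}, .star {2, 2, 2}} : Set SubdividedStar)}

/-- `𝒞₂* = {P₂, S_{2,2}}` (after reduction of the paths modulo 3). -/
def set2s : Set SubdividedStar :=
  {S | S.reduce ∈ ({.star {1}, .star {2, 2}} : Set SubdividedStar)}

/-- Stars with Grundy value `i` and, after reduction modulo 3, one or three paths of length 2. -/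
def setBox (i : ℕ) : Set SubdividedStar :=
  {S | S.grundy = i ∧ (S.reduce.twos = 1 ∨ S.reduce.twos = 3)}

/-- Stars with Grundy value `i` lying in none of `𝒞₁*`, `𝒞₂*`, `𝒞₂□`, `𝒞₃□`. -/
def setPlain (i : ℕ) : Set SubdividedStar :=
  {S | S.grundy = i ∧ S ∉ set1s ∧ S ∉ set2s ∧ S ∉ setBox 2 ∧ S ∉ setBox 3}

/-- The set of subdivided stars with the given class name. -/
def toSet : StarClass → Set SubdividedStar
  | c0 => setPlain 0
  | c1 => setPlain 1
  | c1s => set1s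
  | c2 => setPlain 2
  | c2s => set2s
  | c2b => setBox 2
  | c3 => setPlain 3
  | c3b => setBox 3

/-- The table of Grundy values of `S–S'`; `none` stands for the entry `⊕` (nim-sum). -/
def table : StarClass → StarClass → Option ℕ
  | c1s, c1s => some 2
  | c1s, c2s => some 0
  | c2s, c1s => some 0
  | c2s, c2s => some 1
  | c2s, c2b => some 1
  | c2b, c2s => some 1
  | c2s, c3b => some 0
  | c3b, c2s => some 0
  | _, _ => none

end StarClass

/-! On a connected graph, a move of 0.33 deletes a vertex or an edge so that the rest is empty or
connected. In a bistar, a move that keeps some centre either shortens one arm by 1 or 2 vertices or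
deletes a whole side of at most two vertices. A move that leaves no centre exists only if the bistar
is a path, whose Grundy value is its order modulo 3.

Let a star have `a` arms of length 1 and `b` arms of length 2 modulo 3. Its class `ofCounts a b` is
eventually 2-periodic in each variable, so a 4 by 6 table describes it. The core result is
`grundy_position`: by induction on the number of vertices, the Grundy value of a bistar is
`pairValue` of the classes of its two sides. The mex condition splits into two finite checks.

No option has the same value. An arm move shifts `(a, b)` by one of six steps, and classes related
by such a step are `Separated`: they disagree against every class on the other side. The class `c0`
of an absent side is likewise separated from `c1s` and `c2s`, the classes of sides with one or two
vertices.

Every smaller value is reached. `required` lists options that depend on the class only;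
`exists_hasOption` produces them and `exists_required_of_lt` says that they suffice. The one
exception is a centre without arms: it has class `c1s` but no option of class `c2s`, so it is
treated separately with `exists_required_of_lt_c1s`.

All positions are finite subsets of one infinite graph `bispider`, so a move only changes the set of
centres and the arm lengths; `grundy_image` transports the result to actual bistars. Since the eight
rows of `pairValue` are distinct and every class is realised, `Sim1` is equality of `starClass`, and
`mem_toSet` identifies the fibres with the sets of the statement. -/

/-! ### Mex, and equivalence as equality of Grundy values -/

namespace ImpartialGame

variable {P Q : Type}

/-- The mex characterisation of the Grundy value. -/
theorem grundy_eq_of_mex (g : ImpartialGame P) {J : P} {n : ℕ}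
    (h1 : ∀ J', g.Opt J J' → g.grundy J' ≠ n)
    (h2 : ∀ m < n, ∃ J', g.Opt J J' ∧ g.grundy J' = m) : g.grundy J = n := by
  rw [grundy_eq]
  refine le_antisymm (Nat.sInf_le h1) ?_
  by_contra hlt
  obtain ⟨J', hJ', he⟩ := h2 _ (not_le.mp hlt)
  exact Nat.sInf_mem (s := {n | ∀ J', g.Opt J J' → g.grundy J' ≠ n}) ⟨n, h1⟩ J' hJ' he

theorem grundy_spec (g : ImpartialGame P) (J : P) :
    (∀ J', g.Opt J J' → g.grundy J' ≠ g.grundy J) ∧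
      ∀ m < g.grundy J, ∃ J', g.Opt J J' ∧ g.grundy J' = m := by
  have hne : {n | ∀ J', g.Opt J J' → g.grundy J' ≠ n}.Nonempty := by
    obtain ⟨n, hn⟩ := ((g.finite_opt J).image g.grundy).exists_notMem
    exact ⟨n, fun J' h he => hn ⟨J', h, he⟩⟩
  have key := grundy_eq g J
  constructor
  · rw [key]
    exact Nat.sInf_mem hne
  · intro m hm
    rw [key] at hm
    have := Nat.notMem_of_lt_sInf hm
    simpa using this

/-- Two positions are equivalent if and only if they have the same Grundy value. -/
theorem equivalent_iff (g : ImpartialGame P) (h : ImpartialGame Q) (J : P) (K : Q) :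
    g.Equivalent J h K ↔ g.grundy J = h.grundy K := by
  unfold Equivalent
  suffices ∀ p : P × Q, (g.sum h).IsPPosition p ↔ g.grundy p.1 = h.grundy p.2 from this (J, K)
  intro p
  induction p using (g.sum h).wf.induction with
  | _ p ih =>
  obtain ⟨J, K⟩ := p
  rw [isPPosition_iff]
  constructor
  · intro hp
    rcases lt_trichotomy (g.grundy J) (h.grundy K) with hlt | heq | hlt
    · obtain ⟨K', hK, he⟩ := (h.grundy_spec K).2 _ hlt
      have ho : (g.sum h).Opt (J, K) (J, K') := Or.inr ⟨rfl, hK⟩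
      exact absurd ((ih _ ho).2 he.symm) (hp _ ho)
    · exact heq
    · obtain ⟨J', hJ, he⟩ := (g.grundy_spec J).2 _ hlt
      have ho : (g.sum h).Opt (J, K) (J', K) := Or.inl ⟨hJ, rfl⟩
      exact absurd ((ih _ ho).2 he) (hp _ ho)
  · rintro heq ⟨J', K'⟩ ho
    rw [ih _ ho]
    rcases ho with ⟨h1, h2⟩ | ⟨h1, h2⟩
    · dsimp only at h1 h2 heq ⊢
      subst h2
      rw [← heq]
      exact (g.grundy_spec J).1 _ h1
    · dsimp only at h1 h2 heq ⊢
      subst h1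
      rw [heq]
      exact ((h.grundy_spec K).1 _ h2).symm

end ImpartialGame

/-! ### Connected positions of the game `0.33` -/

section Connected

variable {V W : Type}

/-- The finite set `A` induces an empty or connected subgraph, in terms of cuts. -/
def CutConnected (G : SimpleGraph V) (A : Finset V) : Prop :=
  ∀ P : V → Prop, (∀ x ∈ A, ∀ y ∈ A, G.Adj x y → P x → P y) → ∀ x ∈ A, ∀ y ∈ A, P x → P y

theorem cutConnected_iff (G : SimpleGraph V) (A : Finset V) :
    CutConnected G A ↔ (G.induce (A : Set V)).Preconnected := by
  constructor
  · rintro h ⟨x, hx⟩ ⟨y, hy⟩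
    have := h (fun v => ∃ hv : v ∈ (A : Set V), (G.induce (A : Set V)).Reachable ⟨x, hx⟩ ⟨v, hv⟩)
      (by
        rintro u hu v hv huv ⟨hu', hr⟩
        exact ⟨hv, hr.trans (SimpleGraph.Adj.reachable (by simpa using huv))⟩)
      x hx y hy ⟨hx, SimpleGraph.Reachable.refl _⟩
    exact this.2
  · intro h P hP x hx y hy hPx
    obtain ⟨w⟩ := h ⟨x, hx⟩ ⟨y, hy⟩
    suffices ∀ u v : (A : Set V), (G.induce (A : Set V)).Walk u v → P u → P v from this _ _ w hPx
    intro u v w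
    induction w with
    | nil => exact id
    | cons hadj _ ih => exact fun hu => ih (hP _ (Subtype.coe_prop _) _ (Subtype.coe_prop _) hadj hu)

theorem CutConnected.empty (G : SimpleGraph V) : CutConnected G ∅ := by
  intro P _ x hx
  simp at hx

theorem componentOf_eq {G : SimpleGraph V} {A X : Finset V} (hA : CutConnected G A) (hX : X ⊆ A)
    (hne : X.Nonempty) : componentOf G A X = A := by
  ext v
  constructor
  · rintro ⟨x, _, _, hv, _⟩
    exact hv
  · intro hv
    obtain ⟨x, hx⟩ := hne
    exact ⟨x, hx, hX hx, hv, (cutConnected_iff G A).1 hA _ _⟩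

variable [DecidableEq W]

/-- An adjacency-preserving injection maps connected sets to connected sets. -/
theorem CutConnected.image_iff {G : SimpleGraph V} {H : SimpleGraph W} {A : Finset V} {φ : V → W}
    (hinj : Set.InjOn φ A) (hadj : ∀ x ∈ A, ∀ y ∈ A, H.Adj (φ x) (φ y) ↔ G.Adj x y) :
    CutConnected H (A.image φ) ↔ CutConnected G A := by
  constructor
  · intro h P hP x hx y hy hPx
    obtain ⟨z, hz, he, hPz⟩ := h (fun w => ∃ z ∈ A, φ z = w ∧ P z) (by
      rintro _ _ b hb hab ⟨a, ha, rfl, hPa⟩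
      obtain ⟨c, hc, rfl⟩ := Finset.mem_image.1 hb
      exact ⟨c, hc, rfl, hP a ha c hc ((hadj a ha c hc).1 hab) hPa⟩)
      (φ x) (Finset.mem_image_of_mem _ hx) (φ y) (Finset.mem_image_of_mem _ hy) ⟨x, hx, rfl, hPx⟩
    rwa [← hinj hz hy he]
  · intro h P hP a ha b hb hPa
    obtain ⟨x, hx, rfl⟩ := Finset.mem_image.1 ha
    obtain ⟨y, hy, rfl⟩ := Finset.mem_image.1 hb
    exact h (fun z => P (φ z)) (fun u hu v hv huv => hP _ (Finset.mem_image_of_mem _ hu) _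
      (Finset.mem_image_of_mem _ hv) ((hadj u hu v hv).2 huv)) x hx y hy hPa

variable [DecidableEq V]

/-- Removing a vertex with at most one neighbour preserves connectedness. -/
theorem CutConnected.erase_leaf {G : SimpleGraph V} {A : Finset V} (h : CutConnected G A) (x y : V)
    (hy : ∀ z ∈ A, G.Adj x z → z = y) : CutConnected G (A.erase x) := by
  classical
  intro P hP u hu v hv hPu
  rw [Finset.mem_erase] at hu hv
  -- A cut of the smaller set extends to `A` by putting the leaf `x` on the side of its only
  -- possible neighbour `y`.
  have := h (fun z => if z = x then P y else P z) ?_ u hu.2 v hv.2 (by simpa [hu.1] using hPu)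
  · simpa [hv.1] using this
  · intro a ha b hb hab
    by_cases hax : a = x
    · subst hax
      have := hy b hb hab
      subst this
      simp [hab.ne']
    · by_cases hbx : b = x
      · subst hbx
        have := hy a ha hab.symm
        subst this
        simp [hab.ne]
      · simpa [hax, hbx] using hP a (Finset.mem_erase.2 ⟨hax, ha⟩) b (Finset.mem_erase.2 ⟨hbx, hb⟩) hab

/-- `B` is obtained from `A` by removing one vertex or two adjacent ones. -/
def RemovesOneOrTwo (G : SimpleGraph V) (A B : Finset V) : Prop :=
  (∃ x ∈ A, B = A.erase x) ∨ ∃ x ∈ A, ∃ y ∈ A, G.Adj x y ∧ B = (A.erase x).erase y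

theorem RemovesOneOrTwo.card {G : SimpleGraph V} {A B : Finset V} (h : RemovesOneOrTwo G A B) :
    A.card = B.card + 1 ∨ A.card = B.card + 2 := by
  rcases h with ⟨x, hx, rfl⟩ | ⟨x, hx, y, hy, hxy, rfl⟩
  · left
    rw [Finset.card_erase_add_one hx]
  · right
    have hy' : y ∈ A.erase x := Finset.mem_erase.2 ⟨hxy.ne', hy⟩
    rw [← Finset.card_erase_add_one hx, ← Finset.card_erase_add_one hy']

theorem RemovesOneOrTwo.subset {G : SimpleGraph V} {A B : Finset V} (h : RemovesOneOrTwo G A B) :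
    B ⊆ A := by
  rcases h with ⟨x, hx, rfl⟩ | ⟨x, hx, y, hy, hxy, rfl⟩
  · exact Finset.erase_subset _ _
  · exact (Finset.erase_subset _ _).trans (Finset.erase_subset _ _)

theorem removesOneOrTwo_iff (G : SimpleGraph V) (A B : Finset V) :
    RemovesOneOrTwo G A B ↔ ∃ X ⊆ A, (G.induce (X : Set V)).Connected ∧
      (X.card = 1 ∨ X.card = 2) ∧ B = A \ X := by
  constructor
  · rintro (⟨x, hx, rfl⟩ | ⟨x, hx, y, hy, hxy, rfl⟩)
    · refine ⟨{x}, by simpa using hx, ?_, by simp, by rw [Finset.erase_eq]⟩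
      rw [Finset.coe_singleton, SimpleGraph.induce_singleton_eq_top]
      exact SimpleGraph.connected_top
    · refine ⟨{x, y}, by intro z; simp; rintro (rfl | rfl) <;> assumption, ?_,
        Or.inr (Finset.card_pair hxy.ne), ?_⟩
      · rw [Finset.coe_pair]
        exact SimpleGraph.induce_pair_connected_of_adj hxy
      · ext z; simp; tauto
  · rintro ⟨X, hX, hc, h1 | h2, rfl⟩
    · obtain ⟨x, rfl⟩ := Finset.card_eq_one.1 h1
      exact Or.inl ⟨x, by simpa using hX, by rw [Finset.erase_eq]⟩
    · obtain ⟨x, y, hxy, rfl⟩ := Finset.card_eq_two.1 h2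
      refine Or.inr ⟨x, hX (by simp), y, hX (by simp), ?_, by ext z; simp; tauto⟩
      -- If `x` and `y` were not adjacent, `{x}` would be a cut of the pair.
      by_contra hadj
      have := (cutConnected_iff G {x, y}).2 hc.preconnected (fun z => z = x) (by
        intro a ha b hb hab hax
        subst hax
        simp only [Finset.mem_insert, Finset.mem_singleton] at hb
        rcases hb with rfl | rfl
        · rfl
        · exact absurd hab hadj) x (by simp) y (by simp) rfl
      exact hxy this.symm

/-- The moves of the game `0.33` on a connected graph. -/
theorem opt_iff_of_cutConnected {G : SimpleGraph V} {A : Finset V} (hA : CutConnected G A)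
    (B : Finset V) :
    (octalGame code033 G).Opt A B ↔ RemovesOneOrTwo G A B ∧ CutConnected G B := by
  rw [removesOneOrTwo_iff]
  constructor
  · rintro ⟨X, ⟨hX, hc, hl⟩, rfl⟩
    have hne : X.Nonempty := by
      obtain ⟨⟨x, hx⟩⟩ := hc.nonempty
      exact ⟨x, hx⟩
    rw [componentOf_eq hA hX hne, ← Finset.coe_sdiff] at hl
    have hcard : X.card = 1 ∨ X.card = 2 := by
      by_contra hcon
      have h0 : code033 X.card = 0 := by simp only [code033, if_neg hcon]
      rw [h0] at hl
      simp at hl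
    refine ⟨⟨X, hX, hc, hcard, rfl⟩, ?_⟩
    -- The code digit 3 is 011 in binary: the remainder may be empty or connected, never
    -- disconnected. As `CutConnected` admits the empty set, it covers both allowed cases at once.
    have h3 : code033 X.card = 3 := by simp only [code033, if_pos hcard]
    rw [h3] at hl
    rcases hl with ⟨h, _⟩ | ⟨h, _⟩ | ⟨_, _, h⟩
    · rw [Finset.coe_eq_empty] at h
      rw [h]
      exact CutConnected.empty G
    · exact (cutConnected_iff _ _).2 h.preconnected
    · exact absurd h (by decide)
  · rintro ⟨⟨X, hX, hc, hcard, rfl⟩, hB⟩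
    have hne : X.Nonempty := by
      obtain ⟨⟨x, hx⟩⟩ := hc.nonempty
      exact ⟨x, hx⟩
    refine ⟨X, ⟨hX, hc, ?_⟩, rfl⟩
    have h3 : code033 X.card = 3 := by simp only [code033, if_pos hcard]
    rw [componentOf_eq hA hX hne, ← Finset.coe_sdiff, h3]
    rcases (A \ X).eq_empty_or_nonempty with h | h
    · left
      rw [h]
      exact ⟨Finset.coe_empty, by decide⟩
    · right; left
      obtain ⟨x, hx⟩ := h
      have : Nonempty ((A \ X : Finset V) : Set V) := ⟨⟨x, hx⟩⟩
      exact ⟨⟨(cutConnected_iff _ _).1 hB⟩, by decide⟩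

theorem image_erase_of_injOn {A : Finset V} {φ : V → W} (hinj : Set.InjOn φ A) {x : V}
    (hx : x ∈ A) : (A.erase x).image φ = (A.image φ).erase (φ x) := by
  ext w
  simp only [Finset.mem_image, Finset.mem_erase]
  constructor
  · rintro ⟨a, ⟨hax, ha⟩, rfl⟩
    exact ⟨fun he => hax (hinj ha hx he), a, ha, rfl⟩
  · rintro ⟨hne, a, ha, rfl⟩
    exact ⟨a, ⟨fun he => hne (by rw [he]), ha⟩, rfl⟩

theorem image_erase_erase_of_injOn {A : Finset V} {φ : V → W} (hinj : Set.InjOn φ A) {x y : V}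
    (hx : x ∈ A) (hy : y ∈ A) (hxy : x ≠ y) :
    ((A.erase x).erase y).image φ = ((A.image φ).erase (φ x)).erase (φ y) := by
  rw [image_erase_of_injOn (hinj.mono (by simp)) (Finset.mem_erase.2 ⟨hxy.symm, hy⟩),
    image_erase_of_injOn hinj hx]

/-- Grundy values are invariant under isomorphism of connected positions. -/
theorem grundy_image {G : SimpleGraph V} {H : SimpleGraph W} {φ : V → W} {A : Finset V}
    (hA : CutConnected G A) (hinj : Set.InjOn φ A)
    (hadj : ∀ x ∈ A, ∀ y ∈ A, H.Adj (φ x) (φ y) ↔ G.Adj x y) :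
    (octalGame code033 H).grundy (A.image φ) = (octalGame code033 G).grundy A := by
  induction A using Finset.strongInduction with
  | H A ih =>
  have hA' : CutConnected H (A.image φ) := (CutConnected.image_iff hinj hadj).2 hA
  have key : ∀ B, RemovesOneOrTwo G A B → CutConnected G B →
      (octalGame code033 H).grundy (B.image φ) = (octalGame code033 G).grundy B := by
    intro B hB hc
    have hsub := hB.subset
    refine ih B (hsub.ssubset_of_ne ?_) hc (hinj.mono hsub)
      (fun x hx y hy => hadj x (hsub hx) y (hsub hy))
    rintro rfl
    rcases hB.card with h | h <;> omega
  have fwd : ∀ B, RemovesOneOrTwo G A B → RemovesOneOrTwo H (A.image φ) (B.image φ) := by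
    rintro B (⟨x, hx, rfl⟩ | ⟨x, hx, y, hy, hxy, rfl⟩)
    · exact Or.inl ⟨φ x, Finset.mem_image_of_mem _ hx, image_erase_of_injOn hinj hx⟩
    · exact Or.inr ⟨φ x, Finset.mem_image_of_mem _ hx, φ y, Finset.mem_image_of_mem _ hy,
        (hadj x hx y hy).2 hxy, image_erase_erase_of_injOn hinj hx hy hxy.ne⟩
  have bwd : ∀ B', RemovesOneOrTwo H (A.image φ) B' →
      ∃ B, RemovesOneOrTwo G A B ∧ B' = B.image φ := by
    rintro B' (⟨x', hx', rfl⟩ | ⟨x', hx', y', hy', hxy, rfl⟩)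
    · obtain ⟨x, hx, rfl⟩ := Finset.mem_image.1 hx'
      exact ⟨_, Or.inl ⟨x, hx, rfl⟩, (image_erase_of_injOn hinj hx).symm⟩
    · obtain ⟨x, hx, rfl⟩ := Finset.mem_image.1 hx'
      obtain ⟨y, hy, rfl⟩ := Finset.mem_image.1 hy'
      have hxy' := (hadj x hx y hy).1 hxy
      exact ⟨_, Or.inr ⟨x, hx, y, hy, hxy', rfl⟩,
        (image_erase_erase_of_injOn hinj hx hy hxy'.ne).symm⟩
  have conn : ∀ B, RemovesOneOrTwo G A B → (CutConnected H (B.image φ) ↔ CutConnected G B) :=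
    fun B hB => CutConnected.image_iff (hinj.mono hB.subset)
      (fun x hx y hy => hadj x (hB.subset hx) y (hB.subset hy))
  apply ImpartialGame.grundy_eq_of_mex
  · intro B' hB'
    rw [opt_iff_of_cutConnected hA'] at hB'
    obtain ⟨B, hB, rfl⟩ := bwd B' hB'.1
    have hc := (conn B hB).1 hB'.2
    rw [key B hB hc]
    exact ((octalGame code033 G).grundy_spec A).1 B ((opt_iff_of_cutConnected hA B).2 ⟨hB, hc⟩)
  · intro m hm
    obtain ⟨B, hB, rfl⟩ := ((octalGame code033 G).grundy_spec A).2 m hm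
    rw [opt_iff_of_cutConnected hA] at hB
    exact ⟨B.image φ, (opt_iff_of_cutConnected hA' _).2 ⟨fwd B hB.1, (conn B hB.1).2 hB.2⟩,
      key B hB.1 hB.2⟩

end Connected

/-! ### The algebra of the eight classes -/

namespace StarClass

instance : DecidableEq StarClass := fun a b => by
  cases a <;> cases b <;> first | exact isTrue rfl | exact isFalse (by nofun)

instance : Fintype StarClass where
  elems := {c0, c1, c1s, c2, c2s, c2b, c3, c3b}
  complete := by intro c; cases c <;> decide

/-- The Grundy value of the stars of a class. -/
def value : StarClass → ℕ
  | c0 => 0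
  | c1 => 1
  | c1s => 1
  | c2 => 2
  | c2s => 2
  | c2b => 2
  | c3 => 3
  | c3b => 3

/-- The Grundy value of a bistar whose two stars lie in the given classes. -/
def pairValue (c c' : StarClass) : ℕ := (table c c').getD (c.value ^^^ c'.value)

/-- The number of paths of length 1 modulo 3, up to the eventual period 2. -/
def capOne : ℕ → Fin 4
  | 0 => 0
  | a + 1 => ![1, 2, 3, 2] (capOne a)

/-- The number of paths of length 2 modulo 3, up to the eventual period 2. -/
def capTwo : ℕ → Fin 6
  | 0 => 0
  | b + 1 => ![1, 2, 3, 4, 5, 4] (capTwo b)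

/-- The class of a star in terms of the capped numbers of its paths. -/
def ofCap (x : Fin 4) (y : Fin 6) : StarClass :=
  ![![c1s, c0, c2s, c1s, c0, c2],
    ![c2s, c1s, c0, c2b, c1, c3],
    ![c0, c2b, c1, c3b, c0, c2],
    ![c1, c3b, c0, c2b, c1, c3]] x y

/-- The class of a star with `a` paths of length 1 and `b` paths of length 2 modulo 3. -/
def ofCounts (a b : ℕ) : StarClass := ofCap (capOne a) (capTwo b)

/-- Exchanging a star of the class `c` with a star of the class `c'` always changes the Grundy
value of a bistar. -/
def Separated (c c' : StarClass) : Prop := ∀ d, pairValue c d ≠ pairValue c' d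

instance : DecidableRel Separated := fun c c' =>
  inferInstanceAs (Decidable (∀ d, pairValue c d ≠ pairValue c' d))

theorem Separated.symm {c c' : StarClass} (h : Separated c c') : Separated c' c :=
  fun d => (h d).symm

theorem pairValue_comm (c c' : StarClass) : pairValue c c' = pairValue c' c := by
  revert c c'; decide

theorem pairValue_c0 (c : StarClass) : pairValue c c0 = c.value := by
  revert c; decide

/-- The rows of the table are pairwise distinct, which is what keeps the eight classes apart under
`Sim1`. -/
theorem pairValue_left_injective {c c' : StarClass} (h : ∀ d, pairValue c d = pairValue c' d) :
    c = c' := by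
  revert c c'; decide

/-- Together with the next two lemmas and symmetry, this covers all changes of the counts caused by
moving one arm to another residue modulo 3. The capped counts of a successor depend only on the
capped counts, so 24 cases suffice. -/
theorem separated_succ_left (a b : ℕ) : Separated (ofCounts (a + 1) b) (ofCounts a b) := by
  unfold ofCounts
  rw [capOne]
  generalize capOne a = x
  generalize capTwo b = y
  revert x y
  decide

theorem separated_succ_right (a b : ℕ) : Separated (ofCounts a (b + 1)) (ofCounts a b) := by
  unfold ofCounts
  rw [capTwo]
  generalize capOne a = x
  generalize capTwo b = y
  revert x y
  decide

theorem separated_succ_succ (a b : ℕ) : Separated (ofCounts a (b + 1)) (ofCounts (a + 1) b) := by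
  unfold ofCounts
  rw [capTwo, capOne]
  generalize capOne a = x
  generalize capTwo b = y
  revert x y
  decide

/-- Sets of classes such that every star of the given class has an option in each of them. -/
def required : StarClass → List (List StarClass)
  | c0 => []
  | c1 => [[c0]]
  | c1s => [[c0], [c2s]]
  | c2 => [[c0], [c1]]
  | c2s => [[c0], [c1s]]
  | c2b => [[c0], [c1], [c1s, c3b]]
  | c3 => [[c0], [c1], [c2]]
  | c3b => [[c0], [c1], [c2b]]

/-- The whole list `l` must yield `n`, because an actual star is only known to have an option in
some class of `l`. -/
theorem exists_required_of_lt : ∀ c c' : StarClass, ∀ n < pairValue c c',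
    (∃ l ∈ required c, ∀ d ∈ l, pairValue d c' = n) ∨
      ∃ l ∈ required c', ∀ d ∈ l, pairValue c d = n := by
  intro c
  cases c <;> decide

/-- Against a star of another class, options of class `c0` suffice for the class `c1s`. -/
theorem exists_required_of_lt_c1s : ∀ c' : StarClass, ∀ n < pairValue c1s c',
    pairValue c0 c' = n ∨ ∃ l ∈ required c', ∀ d ∈ l, pairValue c1s d = n := by
  decide

/-- This lemma and the next two match `required` against the options that the counts alone
guarantee: dropping one vertex of an arm of residue 1, or one or two vertices of an arm of residue
2. The counts `(0, 0)` and `(1, 0)` are left out, since there the actual lengths matter. -/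
theorem exists_required_succ_zero (a : ℕ) :
    ∀ l ∈ required (ofCounts (a + 2) 0), ofCounts (a + 1) 0 ∈ l := by
  unfold ofCounts
  rw [capOne, capOne]
  generalize capOne a = x
  revert x
  decide

theorem exists_required_zero_succ (b : ℕ) :
    ∀ l ∈ required (ofCounts 0 (b + 1)), ofCounts 0 b ∈ l ∨ ofCounts 1 b ∈ l := by
  unfold ofCounts
  rw [capTwo]
  generalize capTwo b = y
  revert y
  decide

theorem exists_required_succ_succ (a b : ℕ) : ∀ l ∈ required (ofCounts (a + 1) (b + 1)),
    ofCounts a (b + 1) ∈ l ∨ ofCounts (a + 1) b ∈ l ∨ ofCounts (a + 2) b ∈ l := by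
  unfold ofCounts
  rw [capTwo, show capOne (a + 2) = ![1, 2, 3, 2] (capOne (a + 1)) from rfl, capOne]
  generalize capOne a = x
  generalize capTwo b = y
  revert x y
  decide

end StarClass

/-! ### Bistars inside a fixed infinite graph -/

section Bispider

variable {ι : Type}

/-- Two adjacent centres, each path of an infinite family being attached to one of them. -/
def bispider (base : ι → Bool) : SimpleGraph (Bool ⊕ (Σ _ : ι, ℕ)) where
  Adj
    | .inl s, .inl t => s ≠ t
    | .inl s, .inr p => base p.1 = s ∧ p.2 = 0
    | .inr p, .inl s => base p.1 = s ∧ p.2 = 0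
    | .inr p, .inr q => p.1 = q.1 ∧ (p.2 + 1 = q.2 ∨ q.2 + 1 = p.2)
  symm := ⟨by
    rintro (s | p) (t | q) h
    · exact Ne.symm h
    · exact h
    · exact h
    · exact ⟨h.1.symm, h.2.symm⟩⟩
  loopless := ⟨by
    rintro (s | p) h
    · exact h rfl
    · rcases h.2 with h | h <;> omega⟩

variable {base : ι → Bool}

@[simp] theorem bispider_adj_inl_inl (s t : Bool) :
    (bispider base).Adj (.inl s) (.inl t) ↔ s ≠ t := Iff.rfl

@[simp] theorem bispider_adj_inl_inr (s : Bool) (i : ι) (j : ℕ) :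
    (bispider base).Adj (.inl s) (.inr ⟨i, j⟩) ↔ base i = s ∧ j = 0 := Iff.rfl

@[simp] theorem bispider_adj_inr_inl (s : Bool) (i : ι) (j : ℕ) :
    (bispider base).Adj (.inr ⟨i, j⟩) (.inl s) ↔ base i = s ∧ j = 0 := Iff.rfl

@[simp] theorem bispider_adj_inr_inr (i k : ι) (j l : ℕ) :
    (bispider base).Adj (.inr ⟨i, j⟩) (.inr ⟨k, l⟩) ↔ i = k ∧ (j + 1 = l ∨ l + 1 = j) := Iff.rfl

/-- In a connected set containing a centre, the paths start at the centre. -/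
theorem CutConnected.leg_down {B : Finset (Bool ⊕ (Σ _ : ι, ℕ))}
    (hB : CutConnected (bispider base) B) {s : Bool} (hs : .inl s ∈ B) {i : ι} {j l : ℕ}
    (hl : .inr ⟨i, l⟩ ∈ B) (hjl : j ≤ l) : .inr ⟨i, j⟩ ∈ B := by
  by_contra hj
  have hlt : j < l := lt_of_le_of_ne hjl (by rintro rfl; exact hj hl)
  -- Without the vertex `j`, the part of the path beyond it would be cut off from the centre.
  obtain ⟨m, _, hm⟩ := hB (fun z => ∃ m, j < m ∧ z = .inr ⟨i, m⟩) (by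
    rintro _ _ b hb hab ⟨m, hm, rfl⟩
    rcases b with t | ⟨k, n⟩
    · have := ((bispider_adj_inr_inl _ _ _).1 hab).2
      omega
    · obtain ⟨rfl, h⟩ := (bispider_adj_inr_inr _ _ _ _).1 hab
      refine ⟨n, ?_, rfl⟩
      rcases h with h | h
      · omega
      · rcases Nat.lt_or_ge j n with hn | hn
        · exact hn
        · have : n = j := by omega
          subst this
          exact absurd hb hj) (.inr ⟨i, l⟩) hl (.inl s) hs ⟨l, hlt, rfl⟩
  cases hm

/-- A connected set without centres is part of a single path. -/
theorem CutConnected.exists_leg {B : Finset (Bool ⊕ (Σ _ : ι, ℕ))}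
    (hB : CutConnected (bispider base) B) (hc : ∀ s, .inl s ∉ B) :
    B = ∅ ∨ ∃ i, ∀ x ∈ B, ∃ j, x = .inr ⟨i, j⟩ := by
  rcases B.eq_empty_or_nonempty with h | ⟨x, hx⟩
  · exact Or.inl h
  · right
    rcases x with s | ⟨i, l⟩
    · exact absurd hx (hc s)
    · refine ⟨i, fun y hy => hB (fun z => ∃ j, z = .inr ⟨i, j⟩) ?_ _ hx y hy ⟨l, rfl⟩⟩
      rintro _ _ b hb hab ⟨j, rfl⟩
      rcases b with t | ⟨k, n⟩
      · exact absurd hb (hc t)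
      · obtain ⟨rfl, _⟩ := (bispider_adj_inr_inr _ _ _ _).1 hab
        exact ⟨n, rfl⟩

/-- A move seen from one removed vertex `c`; the choice `y = c` encodes the removal of a single
vertex, so later arguments treat both kinds of move together. -/
theorem exists_removed {V : Type} [DecidableEq V] {G : SimpleGraph V} {A B : Finset V}
    (h : RemovesOneOrTwo G A B) {c : V} (hcA : c ∈ A) (hcB : c ∉ B) :
    ∃ y ∈ A, (y = c ∨ G.Adj c y) ∧ ∀ z, z ∈ B ↔ z ∈ A ∧ z ≠ c ∧ z ≠ y := by
  rcases h with ⟨x, hx, rfl⟩ | ⟨x, hx, y, hy, hxy, rfl⟩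
  · have : c = x := by simpa [hcA] using hcB
    subst this
    exact ⟨c, hcA, Or.inl rfl, fun z => by simp; tauto⟩
  · have : c = x ∨ c = y := by
      simp only [Finset.mem_erase, hcA, and_true, not_and, not_not] at hcB
      tauto
    rcases this with rfl | rfl
    · exact ⟨y, hy, Or.inr hxy, fun z => by simp; tauto⟩
    · exact ⟨x, hx, Or.inr hxy.symm, fun z => by simp; tauto⟩

theorem exists_removed_of_removes {V : Type} [DecidableEq V] {G : SimpleGraph V} {A B : Finset V}
    (h : RemovesOneOrTwo G A B) : ∃ c ∈ A, c ∉ B := by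
  rcases h with ⟨x, hx, rfl⟩ | ⟨x, hx, y, hy, hxy, rfl⟩
  · exact ⟨x, hx, by simp⟩
  · exact ⟨x, hx, by simp⟩

/-- The last vertex of a finite nonempty part of a path. -/
theorem exists_last_of_leg {B : Finset (Bool ⊕ (Σ _ : ι, ℕ))} {i : ι}
    (hi : ∀ x ∈ B, ∃ j, x = .inr ⟨i, j⟩) (hne : B.Nonempty) :
    ∃ m, .inr ⟨i, m⟩ ∈ B ∧ ∀ j, .inr ⟨i, j⟩ ∈ B → j ≤ m := by
  let f : Bool ⊕ (Σ _ : ι, ℕ) → ℕ := Sum.elim (fun _ => 0) (fun p => p.2)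
  obtain ⟨x, hx, hmax⟩ := B.exists_max_image f hne
  obtain ⟨m, rfl⟩ := hi x hx
  exact ⟨m, hx, fun j hj => hmax _ hj⟩

variable [DecidableEq ι]

theorem CutConnected.erase_last {B : Finset (Bool ⊕ (Σ _ : ι, ℕ))} {i : ι}
    (hB : CutConnected (bispider base) B) (hi : ∀ x ∈ B, ∃ j, x = .inr ⟨i, j⟩) {m : ℕ}
    (hmax : ∀ j, .inr ⟨i, j⟩ ∈ B → j ≤ m) :
    CutConnected (bispider base) (B.erase (.inr ⟨i, m⟩)) := by
  -- For `m = 0` the truncated `m - 1` is harmless: maximality of `m` then leaves no neighbour in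
  -- `B`.
  refine hB.erase_leaf _ (.inr ⟨i, m - 1⟩) ?_
  intro z hz hadj
  obtain ⟨j, rfl⟩ := hi z hz
  have := hmax j hz
  have h := ((bispider_adj_inr_inr _ _ _ _).1 hadj).2
  have : j = m - 1 := by omega
  rw [this]

/-- The Grundy value of a path avoiding the centres. -/
theorem grundy_leg {B : Finset (Bool ⊕ (Σ _ : ι, ℕ))} {i : ι}
    (hB : CutConnected (bispider base) B) (hi : ∀ x ∈ B, ∃ j, x = .inr ⟨i, j⟩) :
    (octalGame code033 (bispider base)).grundy B = B.card % 3 := by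
  induction hn : B.card using Nat.strong_induction_on generalizing B with
  | _ n ih =>
  subst hn
  have key : ∀ C, RemovesOneOrTwo (bispider base) B C → CutConnected (bispider base) C →
      (octalGame code033 (bispider base)).grundy C = C.card % 3 := by
    intro C hC hc
    refine ih _ ?_ hc (fun x hx => hi x (hC.subset hx)) rfl
    rcases hC.card with h | h <;> omega
  have one : B.card ≠ 0 → ∃ C, (octalGame code033 (bispider base)).Opt B C ∧
      (octalGame code033 (bispider base)).grundy C = (B.card - 1) % 3 := by
    intro h0
    obtain ⟨m, hm, hmax⟩ := exists_last_of_leg hi (Finset.card_ne_zero.1 h0)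
    have h1 : RemovesOneOrTwo (bispider base) B (B.erase (.inr ⟨i, m⟩)) := Or.inl ⟨_, hm, rfl⟩
    have h2 := hB.erase_last hi hmax
    refine ⟨_, (opt_iff_of_cutConnected hB _).2 ⟨h1, h2⟩, ?_⟩
    rw [key _ h1 h2, Finset.card_erase_of_mem hm]
  have two : 2 ≤ B.card → ∃ C, (octalGame code033 (bispider base)).Opt B C ∧
      (octalGame code033 (bispider base)).grundy C = (B.card - 2) % 3 := by
    intro h0
    obtain ⟨m, hm, hmax⟩ := exists_last_of_leg hi (Finset.card_ne_zero.1 (by omega))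
    have h2 := hB.erase_last hi hmax
    have hi' : ∀ x ∈ B.erase (.inr ⟨i, m⟩), ∃ j, x = .inr ⟨i, j⟩ :=
      fun x hx => hi x (Finset.mem_of_mem_erase hx)
    have hc := Finset.card_erase_of_mem hm
    obtain ⟨l, hl, hlmax⟩ := exists_last_of_leg hi' (Finset.card_ne_zero.1 (by omega))
    have hlB := Finset.mem_of_mem_erase hl
    have hlm : l < m := lt_of_le_of_ne (hmax l hlB) (by rintro rfl; simp at hl)
    -- The two last vertices are adjacent, since a gap between them would disconnect `B`.
    have hadj : l + 1 = m := by
      by_contra hne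
      have hlast : ∀ j, j ≤ l ∨ j = m ∨ .inr ⟨i, j⟩ ∉ B := by
        intro j
        by_contra! hj
        have := hlmax j (Finset.mem_erase.2 ⟨by simpa using hj.2.1, hj.2.2⟩)
        omega
      obtain ⟨j, hj, he⟩ := hB (fun z => ∃ j, j ≤ l ∧ z = .inr ⟨i, j⟩) (by
        rintro _ _ b hb hab ⟨j, hj, rfl⟩
        obtain ⟨k, rfl⟩ := hi b hb
        have h := ((bispider_adj_inr_inr _ _ _ _).1 hab).2
        refine ⟨k, ?_, rfl⟩
        rcases hlast k with h' | h' | h'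
        · exact h'
        · omega
        · exact absurd hb h') (.inr ⟨i, l⟩) hlB (.inr ⟨i, m⟩) hm ⟨l, le_rfl, rfl⟩
      simp only [Sum.inr.injEq, Sigma.mk.injEq, heq_eq_eq, true_and] at he
      omega
    have h1 : RemovesOneOrTwo (bispider base) B ((B.erase (.inr ⟨i, m⟩)).erase (.inr ⟨i, l⟩)) :=
      Or.inr ⟨_, hm, _, hlB, by simp [hadj], rfl⟩
    have h3 := h2.erase_last hi' hlmax
    refine ⟨_, (opt_iff_of_cutConnected hB _).2 ⟨h1, h3⟩, ?_⟩
    rw [key _ h1 h3, Finset.card_erase_of_mem hl, hc, Nat.sub_sub]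
  apply ImpartialGame.grundy_eq_of_mex
  · intro C hC
    rw [opt_iff_of_cutConnected hB] at hC
    rw [key _ hC.1 hC.2]
    rcases hC.1.card with h | h <;> omega
  · intro m hm
    -- The values below `B.card % 3` are among 0 and 1, and dropping one or two vertices at the end
    -- reaches them.
    have : m = (B.card - 1) % 3 ∧ B.card ≠ 0 ∨ m = (B.card - 2) % 3 ∧ 2 ≤ B.card := by omega
    rcases this with ⟨rfl, h⟩ | ⟨rfl, h⟩
    · exact one h
    · exact two h

end Bispider

/-! ### Positions given by a set of centres and arm lengths -/

section Position

open StarClass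

variable {ι : Type}

/-- Nonempty paths are attached to centres that are present. -/
def Attached (base : ι → Bool) (D : Finset Bool) (f : ι → ℕ) : Prop :=
  ∀ i, 0 < f i → base i ∈ D

variable {base : ι → Bool} {D : Finset Bool} {f : ι → ℕ}

/-- The lengths of the paths after removal of the side `s`. -/
def clearSide (base : ι → Bool) (s : Bool) (f : ι → ℕ) (i : ι) : ℕ :=
  if base i = s then 0 else f i

theorem Attached.clearSide (h : Attached base D f) (s : Bool) :
    Attached base (D.erase s) (clearSide base s f) := by
  intro i hi
  unfold _root_.clearSide at hi
  split_ifs at hi with hs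
  · omega
  · exact Finset.mem_erase.2 ⟨hs, h i hi⟩

/-- The side `s` consists of one or two vertices. -/
def Removable (base : ι → Bool) (s : Bool) (f : ι → ℕ) : Prop :=
  (∀ i, base i = s → f i = 0) ∨
    ∃ i, base i = s ∧ f i = 1 ∧ ∀ k, k ≠ i → base k = s → f k = 0

theorem Attached.update [DecidableEq ι] (h : Attached base D f) (i : ι) (d : ℕ) :
    Attached base D (Function.update f i (f i - d)) := by
  intro k hk
  apply h
  by_cases hki : k = i
  · subst hki
    simp at hk
    omega
  · simpa [hki] using hk

variable [Fintype ι]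

/-- The bistar with set of centres `D` and paths of lengths `f`. -/
def position (D : Finset Bool) (f : ι → ℕ) : Finset (Bool ⊕ (Σ _ : ι, ℕ)) :=
  D.disjSum (Finset.univ.sigma fun i => Finset.range (f i))

@[simp] theorem inl_mem_position (D : Finset Bool) (f : ι → ℕ) (s : Bool) :
    .inl s ∈ position D f ↔ s ∈ D := by
  simp [position]

@[simp] theorem inr_mem_position (D : Finset Bool) (f : ι → ℕ) (i : ι) (j : ℕ) :
    .inr ⟨i, j⟩ ∈ position D f ↔ j < f i := by
  simp [position]

theorem card_position (D : Finset Bool) (f : ι → ℕ) :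
    (position D f).card = D.card + ∑ i, f i := by
  simp [position]

/-- No cut separates a vertex from its centre, by induction along the arm, nor the two centres from
each other. -/
theorem cutConnected_position (h : Attached base D f) :
    CutConnected (bispider base) (position D f) := by
  intro P hP
  have hsymm : ∀ x ∈ position D f, ∀ y ∈ position D f, (bispider base).Adj x y → (P x ↔ P y) :=
    fun x hx y hy hxy => ⟨hP x hx y hy hxy, hP y hy x hx hxy.symm⟩
  have leg : ∀ i j, j < f i → (P (.inr ⟨i, j⟩) ↔ P (.inl (base i))) := by
    intro i j
    induction j with
    | zero =>
      intro hj
      exact hsymm _ (by simpa using hj) _ (by simpa using h i (by omega)) (by simp)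
    | succ j ih =>
      intro hj
      rw [← ih (by omega)]
      exact hsymm _ (by simpa using hj) _ (by simp; omega) (by simp)
  have ctr : ∀ s ∈ D, ∀ t ∈ D, P (.inl s) ↔ P (.inl t) := by
    intro s hs t ht
    by_cases hst : s = t
    · rw [hst]
    · exact hsymm _ (by simpa using hs) _ (by simpa using ht) (by simpa using hst)
  have all : ∀ x ∈ position D f, ∃ s ∈ D, P x ↔ P (.inl s) := by
    rintro (s | ⟨i, j⟩) hx
    · exact ⟨s, by simpa using hx, Iff.rfl⟩
    · have hj : j < f i := by simpa using hx
      exact ⟨base i, h i (by omega), leg i j hj⟩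
  intro x hx y hy hPx
  obtain ⟨s, hs, h1⟩ := all x hx
  obtain ⟨t, ht, h2⟩ := all y hy
  exact h2.2 ((ctr s hs t ht).1 (h1.1 hPx))

/-! ### Classes of the two sides -/

/-- The number of paths at the centre `s` whose length is `r` modulo 3. -/
def countSide (base : ι → Bool) (r : ℕ) (s : Bool) (f : ι → ℕ) : ℕ :=
  ∑ i, if base i = s ∧ f i % 3 = r then 1 else 0

/-- The class of the side `s` of a position. -/
def sideClass (base : ι → Bool) (D : Finset Bool) (f : ι → ℕ) (s : Bool) : StarClass :=
  if s ∈ D then ofCounts (countSide base 1 s f) (countSide base 2 s f) else c0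

/-- Absent arms have length 0 and are counted at residue 0, hence the restriction on `r`. -/
theorem countSide_eq_zero {r : ℕ} (hr : r ≠ 0) {s : Bool} (h : ∀ i, base i = s → f i = 0) :
    countSide base r s f = 0 := by
  refine Finset.sum_eq_zero fun i _ => ?_
  rw [if_neg]
  rintro ⟨h1, h2⟩
  rw [h i h1] at h2
  exact hr h2.symm

theorem sideClass_eq_c1s {s : Bool} (hs : s ∈ D) (h : ∀ i, base i = s → f i = 0) :
    sideClass base D f s = c1s := by
  rw [sideClass, if_pos hs, countSide_eq_zero one_ne_zero h, countSide_eq_zero two_ne_zero h]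
  rfl

theorem sideClass_clearSide_of_ne {s t : Bool} (h : t ≠ s) :
    sideClass base (D.erase s) (clearSide base s f) t = sideClass base D f t := by
  have : ∀ r, countSide base r t (clearSide base s f) = countSide base r t f := by
    intro r
    refine Finset.sum_congr rfl fun i _ => ?_
    by_cases hi : base i = t
    · have : base i ≠ s := by rw [hi]; exact h
      simp [clearSide, this]
    · simp [hi]
  simp [sideClass, this, h]

theorem sideClass_clearSide_self (s : Bool) :
    sideClass base (D.erase s) (clearSide base s f) s = c0 := by
  simp [sideClass]

/-! ### Moves of a position -/

variable [DecidableEq ι]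

theorem removes_arm (i : ι) {d : ℕ} (hd : d = 1 ∨ d = 2) (hdi : d ≤ f i) :
    RemovesOneOrTwo (bispider base) (position D f)
      (position D (Function.update f i (f i - d))) := by
  rcases hd with rfl | rfl
  · refine Or.inl ⟨.inr ⟨i, f i - 1⟩, by simp; omega, ?_⟩
    ext (s | ⟨k, l⟩)
    · simp
    · by_cases hk : k = i
      · subst hk
        simp
        omega
      · simp [hk]
  · refine Or.inr ⟨.inr ⟨i, f i - 1⟩, by simp; omega, .inr ⟨i, f i - 2⟩, by simp; omega,
      by simp; omega, ?_⟩
    ext (s | ⟨k, l⟩)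
    · simp
    · by_cases hk : k = i
      · subst hk
        simp
        omega
      · simp [hk]

/-- All centres survive and the rest is connected, so by `CutConnected.leg_down` each arm stays an
initial segment. The removed vertices are therefore the end of one arm. -/
theorem exists_arm_of_removes {B : Finset (Bool ⊕ (Σ _ : ι, ℕ))}
    (h : RemovesOneOrTwo (bispider base) (position D f) B)
    (hB : CutConnected (bispider base) B) (hD : D.Nonempty) (hc : ∀ s ∈ D, .inl s ∈ B) :
    ∃ i d, (d = 1 ∨ d = 2) ∧ d ≤ f i ∧ B = position D (Function.update f i (f i - d)) := by
  obtain ⟨s, hs⟩ := hD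
  obtain ⟨c, hcA, hcB⟩ := exists_removed_of_removes h
  obtain ⟨y, hyA, hy, hmem⟩ := exists_removed h hcA hcB
  have hyB : y ∉ B := fun hyB => ((hmem y).1 hyB).2.2 rfl
  rcases c with t | ⟨i, j⟩
  · exact absurd (hc t (by simpa using hcA)) hcB
  rcases y with t | ⟨k, l⟩
  · exact absurd (hc t (by simpa using hyA)) hyB
  rw [inr_mem_position] at hcA hyA
  have hki : i = k := by
    rcases hy with hy | hy
    · simp only [Sum.inr.injEq, Sigma.mk.injEq] at hy
      exact hy.1.symm
    · exact ((bispider_adj_inr_inr _ _ _ _).1 hy).1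
  subst hki
  have hjl : j = l ∨ j + 1 = l ∨ l + 1 = j := by
    rcases hy with hy | hy
    · simp only [Sum.inr.injEq, Sigma.mk.injEq, heq_eq_eq, true_and] at hy
      exact Or.inl hy.symm
    · exact Or.inr ((bispider_adj_inr_inr _ _ _ _).1 hy).2
  have hlast : ∀ m, m < f i → m = j ∨ m = l ∨ (m < j ∧ m < l) := by
    intro m hm
    by_contra! hcon
    have hmB : .inr ⟨i, m⟩ ∈ B := by
      rw [hmem]
      simp only [inr_mem_position, ne_eq, Sum.inr.injEq, Sigma.mk.injEq, heq_eq_eq, true_and]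
      exact ⟨hm, hcon.1, hcon.2.1⟩
    rcases Nat.lt_or_ge m j with h1 | h1
    · exact hyB (hB.leg_down (hc s hs) hmB (hcon.2.2 h1))
    · exact hcB (hB.leg_down (hc s hs) hmB h1)
  have hlast' := hlast (f i - 1) (by omega)
  -- The new length of the arm is `min j l`, the smaller of the removed positions.
  refine ⟨i, f i - min j l, by omega, by omega, ?_⟩
  ext (t | ⟨k, m⟩)
  · rw [hmem]
    simp
  · rw [hmem]
    by_cases hk : k = i
    · subst hk
      simp
      omega
    · simp [hk]

/-- Removal of a whole side. -/
theorem removes_side {s : Bool} (hs : s ∈ D) (h : Removable base s f) :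
    RemovesOneOrTwo (bispider base) (position D f)
      (position (D.erase s) (clearSide base s f)) := by
  rcases h with h | ⟨i, hi, h1, h⟩
  · refine Or.inl ⟨.inl s, by simpa using hs, ?_⟩
    ext (t | ⟨k, m⟩)
    · simp
    · by_cases hk : base k = s
      · simp [clearSide, hk, h k hk]
      · simp [clearSide, hk]
  · refine Or.inr ⟨.inl s, by simpa using hs, .inr ⟨i, 0⟩, by simp [h1], by simpa using hi, ?_⟩
    ext (t | ⟨k, m⟩)
    · simp
    · by_cases hk : base k = s
      · by_cases hki : k = i
        · subst hki
          simp [clearSide, hk, h1]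
        · simp [clearSide, hk, h k hki hk]
      · have hki : k ≠ i := by rintro rfl; exact hk hi
        simp [clearSide, hk, hki]

/-- Once the centre `s` is gone, its arms are cut off from the surviving centre `t`. All of them
must vanish in the same move, which removes at most one vertex besides `s`. -/
theorem removable_of_removes {B : Finset (Bool ⊕ (Σ _ : ι, ℕ))}
    (h : RemovesOneOrTwo (bispider base) (position D f) B)
    (hB : CutConnected (bispider base) B) {s t : Bool} (hs : s ∈ D) (hsB : .inl s ∉ B)
    (htB : .inl t ∈ B) :
    Removable base s f ∧ B = position (D.erase s) (clearSide base s f) := by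
  obtain ⟨y, hyA, hy, hmem⟩ := exists_removed h ((inl_mem_position D f s).2 hs) hsB
  have hyB : y ∉ B := fun hyB => ((hmem y).1 hyB).2.2 rfl
  have hst : ∀ r, r ≠ s → r = t := by
    intro r hr
    have : t ≠ s := by rintro rfl; exact hsB htB
    exact (Bool.eq_not.2 hr).trans (Bool.eq_not.2 this).symm
  have hside : ∀ i j, base i = s → .inr ⟨i, j⟩ ∉ B := by
    intro i j hi hjB
    have h0 := hB.leg_down htB hjB (Nat.zero_le j)
    obtain ⟨k, m, hk, he⟩ := hB (fun z => ∃ k m, base k = s ∧ z = .inr ⟨k, m⟩) (by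
      rintro _ _ b hb hab ⟨k, m, hk, rfl⟩
      rcases b with r | ⟨k', m'⟩
      · rw [bispider_adj_inr_inl, hk] at hab
        rw [← hab.1] at hb
        exact absurd hb hsB
      · obtain ⟨rfl, _⟩ := (bispider_adj_inr_inr _ _ _ _).1 hab
        exact ⟨_, m', hk, rfl⟩) _ h0 (.inl t) htB ⟨i, 0, hi, rfl⟩
    cases he
  have hR : Removable base s f := by
    rcases y with r | ⟨i, j⟩
    · left
      intro i hi
      by_contra h0
      refine hside i 0 hi ((hmem _).2 ⟨?_, by simp, by simp⟩)
      rw [inr_mem_position]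
      omega
    · right
      have hadj : base i = s ∧ j = 0 := by
        rcases hy with hy | hy
        · cases hy
        · exact (bispider_adj_inl_inr _ _ _).1 hy
      obtain ⟨hi, rfl⟩ := hadj
      rw [inr_mem_position] at hyA
      refine ⟨i, hi, ?_, ?_⟩
      · by_contra h1
        refine hside i 1 hi ((hmem _).2 ⟨?_, by simp, by simp⟩)
        rw [inr_mem_position]
        omega
      · intro k hk hks
        by_contra h0
        refine hside k 0 hks ((hmem _).2 ⟨?_, by simp, by simpa using hk⟩)
        rw [inr_mem_position]
        omega
  refine ⟨hR, ?_⟩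
  ext (r | ⟨k, m⟩)
  · by_cases hr : r = s
    · subst hr
      simpa using hsB
    · have := hst r hr
      subst this
      have hD : r ∈ D := by simpa using h.subset htB
      simp [htB, hr, hD]
  · by_cases hk : base k = s
    · simpa [clearSide, hk] using hside k m hk
    · rw [hmem]
      rcases y with r | ⟨i, j⟩
      · simp [clearSide, hk]
      · have : base i = s := by
          rcases hy with hy | hy
          · cases hy
          · exact ((bispider_adj_inl_inr _ _ _).1 hy).1
        have hki : k ≠ i := by rintro rfl; exact hk this
        simp [clearSide, hk, hki]

/-- The additive form avoids truncated subtraction when counts change. -/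
theorem sum_update_add (F : ι → ℕ → ℕ) (f : ι → ℕ) (i : ι) (v : ℕ) :
    ∑ k, F k (Function.update f i v k) + F i (f i) = ∑ k, F k (f k) + F i v := by
  rw [← Finset.add_sum_erase _ _ (Finset.mem_univ i),
    ← Finset.add_sum_erase _ (fun k => F k (f k)) (Finset.mem_univ i)]
  have : ∑ k ∈ Finset.univ.erase i, F k (Function.update f i v k) =
      ∑ k ∈ Finset.univ.erase i, F k (f k) := by
    refine Finset.sum_congr rfl fun k hk => ?_
    rw [Function.update_of_ne (Finset.ne_of_mem_erase hk)]
  rw [this, Function.update_self]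
  ring

theorem countSide_update (r : ℕ) (s : Bool) (f : ι → ℕ) (i : ι) (v : ℕ) :
    countSide base r s (Function.update f i v) + (if base i = s ∧ f i % 3 = r then 1 else 0) =
      countSide base r s f + (if base i = s ∧ v % 3 = r then 1 else 0) :=
  sum_update_add (fun k n => if base k = s ∧ n % 3 = r then 1 else 0) f i v

theorem sideClass_update_of_ne {s : Bool} {i : ι} (h : base i ≠ s) (v : ℕ) :
    sideClass base D (Function.update f i v) s = sideClass base D f s := by
  have h1 := countSide_update (base := base) 1 s f i v
  have h2 := countSide_update (base := base) 2 s f i v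
  simp only [h, false_and, if_false, add_zero] at h1 h2
  rw [sideClass, sideClass, h1, h2]

/-- Removing 1 or 2 vertices always changes the residue of the arm, so one arm passes between two of
the three residue classes: six transitions, all separated. -/
theorem separated_sideClass_update {i : ι} (hi : base i ∈ D) {d : ℕ} (hd : d = 1 ∨ d = 2)
    (hdi : d ≤ f i) :
    Separated (sideClass base D f (base i))
      (sideClass base D (Function.update f i (f i - d)) (base i)) := by
  have h1 := countSide_update (base := base) 1 (base i) f i (f i - d)
  have h2 := countSide_update (base := base) 2 (base i) f i (f i - d)
  simp only [sideClass, if_pos hi, true_and] at h1 h2 ⊢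
  generalize countSide base 1 (base i) f = a at *
  generalize countSide base 2 (base i) f = b at *
  generalize countSide base 1 (base i) _ = a' at *
  generalize countSide base 2 (base i) _ = b' at *
  have : (a = a' + 1 ∧ b = b') ∨ (a' = a + 1 ∧ b' = b) ∨ (a = a' ∧ b = b' + 1) ∨
      (a' = a ∧ b' = b + 1) ∨ (a = a' + 1 ∧ b' = b + 1) ∨ (a' = a + 1 ∧ b = b' + 1) := by
    split_ifs at h1 h2 <;> omega
  rcases this with ⟨rfl, rfl⟩ | ⟨rfl, rfl⟩ | ⟨rfl, rfl⟩ | ⟨rfl, rfl⟩ | ⟨rfl, rfl⟩ | ⟨rfl, rfl⟩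
  · exact separated_succ_left _ _
  · exact (separated_succ_left _ _).symm
  · exact separated_succ_right _ _
  · exact (separated_succ_right _ _).symm
  · exact (separated_succ_succ _ _).symm
  · exact separated_succ_succ _ _

theorem sideClass_of_removable {s : Bool} (hs : s ∈ D) (h : Removable base s f) :
    sideClass base D f s = c1s ∨ sideClass base D f s = c2s := by
  rcases h with h | ⟨i, hi, h1, h⟩
  · exact Or.inl (sideClass_eq_c1s hs h)
  · right
    have h0 : ∀ k, base k = s → Function.update f i 0 k = 0 := by
      intro k hk
      by_cases hki : k = i
      · subst hki; simp
      · rw [Function.update_of_ne hki, h k hki hk]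
    have e1 := countSide_update (base := base) 1 s f i 0
    have e2 := countSide_update (base := base) 2 s f i 0
    rw [countSide_eq_zero one_ne_zero h0] at e1
    rw [countSide_eq_zero two_ne_zero h0] at e2
    simp [hi, h1] at e1 e2
    rw [sideClass, if_pos hs, ← e1, ← e2]
    rfl

end Position

/-! ### The predicted value of a position, and the case of paths -/

section PositionValue

open StarClass

variable {ι : Type} [Fintype ι] {base : ι → Bool} {D : Finset Bool} {f : ι → ℕ}

/-- The Grundy value of a position, in terms of the classes of its sides. -/
def positionValue (base : ι → Bool) (D : Finset Bool) (f : ι → ℕ) : ℕ :=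
  pairValue (sideClass base D f true) (sideClass base D f false)

theorem positionValue_eq (s : Bool) :
    positionValue base D f = pairValue (sideClass base D f s) (sideClass base D f (!s)) := by
  cases s
  · exact pairValue_comm _ _
  · rfl

theorem positionValue_singleton (s : Bool) :
    positionValue base {s} f = (sideClass base {s} f s).value := by
  rw [positionValue_eq s, ← pairValue_c0]
  congr 1
  simp [sideClass]

theorem card_le_one_or_univ (hD : D.Nonempty) : (∃ s, D = {s}) ∨ D = Finset.univ := by
  revert D; decide

theorem positionValue_eq_card_of_zero (hD : D.Nonempty) (h : ∀ i, f i = 0) :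
    positionValue base D f = (position D f).card % 3 := by
  rw [card_position, Finset.sum_eq_zero fun i _ => h i]
  rcases card_le_one_or_univ hD with ⟨s, rfl⟩ | rfl
  · rw [positionValue_singleton, sideClass_eq_c1s (by simp) (fun i _ => h i)]
    rfl
  · rw [positionValue, sideClass_eq_c1s (by simp) (fun i _ => h i),
      sideClass_eq_c1s (by simp) (fun i _ => h i)]
    rfl

theorem exists_of_countSide_ne_zero {r : ℕ} {s : Bool} (h : countSide base r s f ≠ 0) :
    ∃ i, base i = s ∧ f i % 3 = r := by
  by_contra! hcon
  refine h (Finset.sum_eq_zero fun i _ => if_neg ?_)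
  rintro ⟨h1, h2⟩
  exact hcon i h1 h2

theorem mod_ne_of_countSide_eq_zero {r : ℕ} {s : Bool} (h : countSide base r s f = 0) {i : ι}
    (hi : base i = s) : f i % 3 ≠ r := by
  intro hr
  have := (Finset.sum_eq_zero_iff.1 h) i (Finset.mem_univ i)
  simp [hi, hr] at this

variable [DecidableEq ι]

theorem countSide_update_zero {r : ℕ} (hr : r ≠ 0) (i : ι) :
    countSide base r (base i) f = countSide base r (base i) (Function.update f i 0) +
      if f i % 3 = r then 1 else 0 := by
  have h := countSide_update (base := base) r (base i) f i 0
  have h0 : ¬ 0 % 3 = r := fun h => hr h.symm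
  simp only [true_and, if_neg h0, add_zero] at h
  exact h.symm

theorem countSide_single {r : ℕ} (hr : r ≠ 0) {i : ι} (h : ∀ k, k ≠ i → f k = 0) :
    countSide base r (base i) f = if f i % 3 = r then 1 else 0 := by
  rw [countSide_update_zero hr, countSide_eq_zero hr, zero_add]
  intro k _
  by_cases hk : k = i
  · subst hk; simp
  · rw [Function.update_of_ne hk, h k hk]

theorem countSide_pair {r : ℕ} (hr : r ≠ 0) {i k : ι} (hik : k ≠ i) (hb : base k = base i)
    (h : ∀ m, m ≠ i → m ≠ k → f m = 0) :
    countSide base r (base i) f =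
      (if f k % 3 = r then 1 else 0) + if f i % 3 = r then 1 else 0 := by
  rw [countSide_update_zero hr, ← hb, countSide_single hr, Function.update_of_ne hik]
  intro m hm
  by_cases hmi : m = i
  · subst hmi; simp
  · rw [Function.update_of_ne hmi, h m hmi hm]

/-- With a single arm the position is a path starting at a centre; this checks the table against the
known value of paths. -/
theorem positionValue_eq_card_of_single (hA : Attached base D f) (hD : D.Nonempty) {i : ι}
    (h : ∀ k, k ≠ i → f k = 0) : positionValue base D f = (position D f).card % 3 := by
  by_cases hi : f i = 0
  · refine positionValue_eq_card_of_zero hD fun k => ?_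
    by_cases hk : k = i
    · rw [hk, hi]
    · exact h k hk
  have hb : base i ∈ D := hA i (by omega)
  have hs : sideClass base D f (base i) =
      ofCounts (if f i % 3 = 1 then 1 else 0) (if f i % 3 = 2 then 1 else 0) := by
    rw [sideClass, if_pos hb, countSide_single one_ne_zero h, countSide_single two_ne_zero h]
  rw [card_position, Finset.sum_eq_single i (fun k _ hk => h k hk) (by simp)]
  have hmod : f i % 3 = 0 ∨ f i % 3 = 1 ∨ f i % 3 = 2 := by omega
  rcases card_le_one_or_univ hD with ⟨s, rfl⟩ | rfl
  · have hbs : base i = s := by simpa using hb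
    subst hbs
    rw [positionValue_singleton, hs, Finset.card_singleton, Nat.add_mod]
    rcases hmod with e | e | e <;> rw [e] <;> decide
  · have hs' : sideClass base Finset.univ f (!base i) = c1s := by
      refine sideClass_eq_c1s (by simp) fun k hk => h k ?_
      rintro rfl
      simp at hk
    rw [positionValue_eq (base i), hs, hs', Finset.card_univ, Fintype.card_bool, Nat.add_mod]
    rcases hmod with e | e | e <;> rw [e] <;> decide

/-- Here the position is a path whose centre is next to an end. It occurs when a move deletes the
centre together with that end. -/
theorem positionValue_eq_card_of_pair {s : Bool} (hA : Attached base {s} f) {i k : ι}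
    (hik : k ≠ i) (hk : f k = 1) (h : ∀ m, m ≠ i → m ≠ k → f m = 0) :
    positionValue base {s} f = (position {s} f).card % 3 := by
  by_cases hi : f i = 0
  · refine positionValue_eq_card_of_single (i := k) hA (by simp) fun m hm => ?_
    by_cases hmi : m = i
    · rw [hmi, hi]
    · exact h m hmi hm
  have hbi : base i = s := by simpa using hA i (by omega)
  have hbk : base k = s := by simpa using hA k (by omega)
  subst hbi
  rw [positionValue_singleton, sideClass, if_pos (by simp), countSide_pair one_ne_zero hik hbk h,
    countSide_pair two_ne_zero hik hbk h, card_position, Finset.card_singleton]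
  have hsum : ∑ m, f m = 1 + f i := by
    have e := sum_update_add (fun _ n => n) f i 0
    rw [Finset.sum_eq_single k, Function.update_of_ne hik, hk] at e
    · omega
    · intro m _ hm
      by_cases hmi : m = i
      · subst hmi; simp
      · rw [Function.update_of_ne hmi, h m hmi hm]
    · simp
  have hmod : f i % 3 = 0 ∨ f i % 3 = 1 ∨ f i % 3 = 2 := by omega
  rw [hsum, hk, ← add_assoc, Nat.add_mod]
  rcases hmod with e | e | e <;> rw [e] <;> decide

/-- If a move removes all centres, then the position is a path. -/
theorem positionValue_eq_card_of_removes (hA : Attached base D f) (hD : D.Nonempty)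
    {B : Finset (Bool ⊕ (Σ _ : ι, ℕ))}
    (h : RemovesOneOrTwo (bispider base) (position D f) B)
    (hB : CutConnected (bispider base) B) (hc : ∀ s, .inl s ∉ B) :
    positionValue base D f = (position D f).card % 3 := by
  obtain ⟨s, hs⟩ := hD
  obtain ⟨y, hyA, hy, hmem⟩ := exists_removed h ((inl_mem_position D f s).2 hs) (hc s)
  have hleg := hB.exists_leg hc
  rcases y with t | ⟨k, j⟩
  -- Only centres were removed, so every nonempty arm survives; as `B` lies in one arm, there is at
  -- most one.
  · have hin : ∀ i, f i ≠ 0 → .inr ⟨i, 0⟩ ∈ B := by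
      intro i hi
      refine (hmem _).2 ⟨?_, by simp, by simp⟩
      rw [inr_mem_position]
      omega
    rcases hleg with rfl | ⟨i, hi⟩
    · exact positionValue_eq_card_of_zero ⟨s, hs⟩ fun i => by
        by_contra h0
        simpa using hin i h0
    · refine positionValue_eq_card_of_single hA ⟨s, hs⟩ (i := i) fun k hk => ?_
      by_contra h0
      obtain ⟨j, hj⟩ := hi _ (hin k h0)
      simp only [Sum.inr.injEq, Sigma.mk.injEq] at hj
      exact hk hj.1
  · have hadj : base k = s ∧ j = 0 := by
      rcases hy with hy | hy
      · cases hy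
      · exact (bispider_adj_inl_inr _ _ _).1 hy
    obtain ⟨hk, rfl⟩ := hadj
    rw [inr_mem_position] at hyA
    have hin : ∀ i j, j < f i → (i ≠ k ∨ j ≠ 0) → .inr ⟨i, j⟩ ∈ B := by
      intro i j hj hne
      refine (hmem _).2 ⟨by simpa using hj, by simp, ?_⟩
      simp only [ne_eq, Sum.inr.injEq, Sigma.mk.injEq, heq_eq_eq]
      tauto
    -- The second removed vertex lies on an arm, so another centre would have survived.
    have hDs : D = {s} := by
      refine Finset.eq_singleton_iff_unique_mem.2 ⟨hs, fun t ht => ?_⟩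
      by_contra hts
      exact hc t ((hmem _).2 ⟨by simpa using ht, by simpa using hts, by simp⟩)
    rcases hleg with rfl | ⟨i, hi⟩
    · refine positionValue_eq_card_of_single hA ⟨s, hs⟩ (i := k) fun m hm => ?_
      by_contra h0
      simpa using hin m 0 (by omega) (Or.inl hm)
    · have hz : ∀ m, m ≠ i → m ≠ k → f m = 0 := by
        intro m hmi hmk
        by_contra h0
        obtain ⟨j, hj⟩ := hi _ (hin m 0 (by omega) (Or.inl hmk))
        simp only [Sum.inr.injEq, Sigma.mk.injEq] at hj
        exact hmi hj.1
      by_cases hki : k = i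
      · subst hki
        exact positionValue_eq_card_of_single hA ⟨s, hs⟩ fun m hm => hz m hm hm
      · subst hDs
        refine positionValue_eq_card_of_pair hA hki ?_ hz
        by_contra h1
        obtain ⟨j, hj⟩ := hi _ (hin k 1 (by omega) (Or.inr one_ne_zero))
        simp only [Sum.inr.injEq, Sigma.mk.injEq] at hj
        exact hki hj.1

/-! ### Existence of options -/

/-- There is a move after which the side `s` has class `c` and the other side is unchanged. -/
def HasOption (base : ι → Bool) (D : Finset Bool) (f : ι → ℕ) (s : Bool) (c : StarClass) : Prop :=
  ∃ D' f', Attached base D' f' ∧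
    RemovesOneOrTwo (bispider base) (position D f) (position D' f') ∧
    sideClass base D' f' s = c ∧ sideClass base D' f' (!s) = sideClass base D f (!s)

theorem hasOption_side (hA : Attached base D f) {s : Bool} (hs : s ∈ D)
    (h : Removable base s f) : HasOption base D f s c0 :=
  ⟨_, _, hA.clearSide s, removes_side hs h, sideClass_clearSide_self s,
    sideClass_clearSide_of_ne (by simp)⟩

/-- The equations `ha` and `hb` determine `a` and `b` as the counts after the move. -/
theorem hasOption_arm (hA : Attached base D f) {i : ι} {d : ℕ} (hd : d = 1 ∨ d = 2)
    (hdi : d ≤ f i) {a b : ℕ}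
    (ha : a + (if f i % 3 = 1 then 1 else 0) =
      countSide base 1 (base i) f + if (f i - d) % 3 = 1 then 1 else 0)
    (hb : b + (if f i % 3 = 2 then 1 else 0) =
      countSide base 2 (base i) f + if (f i - d) % 3 = 2 then 1 else 0) :
    HasOption base D f (base i) (ofCounts a b) := by
  refine ⟨D, _, hA.update i d, removes_arm i hd hdi, ?_, sideClass_update_of_ne (by simp) _⟩
  have h1 := countSide_update (base := base) 1 (base i) f i (f i - d)
  have h2 := countSide_update (base := base) 2 (base i) f i (f i - d)
  simp only [true_and] at h1 h2
  rw [sideClass, if_pos (hA i (by omega))]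
  congr 1 <;> omega

/-- In most cases arms of residue 1 or 2 supply the options. A centre without arms is excluded by
`hne`, because it has no option of class `c2s`. -/
theorem exists_hasOption (hA : Attached base D f) {s : Bool} (hs : s ∈ D)
    (hne : ¬ ∀ i, base i = s → f i = 0) :
    ∀ l ∈ required (sideClass base D f s), ∃ c ∈ l, HasOption base D f s c := by
  rw [sideClass, if_pos hs]
  have one : ∀ a, countSide base 1 s f = a + 1 →
      HasOption base D f s (ofCounts a (countSide base 2 s f)) := by
    intro a ha
    obtain ⟨i, rfl, hi⟩ := exists_of_countSide_ne_zero (show countSide base 1 s f ≠ 0 by omega)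
    exact hasOption_arm hA (d := 1) (Or.inl rfl) (by omega) (by split_ifs <;> omega)
      (by split_ifs <;> omega)
  have two : ∀ b, countSide base 2 s f = b + 1 →
      HasOption base D f s (ofCounts (countSide base 1 s f) b) := by
    intro b hb
    obtain ⟨i, rfl, hi⟩ := exists_of_countSide_ne_zero (show countSide base 2 s f ≠ 0 by omega)
    exact hasOption_arm hA (d := 2) (Or.inr rfl) (by omega) (by split_ifs <;> omega)
      (by split_ifs <;> omega)
  have two' : ∀ b, countSide base 2 s f = b + 1 →
      HasOption base D f s (ofCounts (countSide base 1 s f + 1) b) := by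
    intro b hb
    obtain ⟨i, rfl, hi⟩ := exists_of_countSide_ne_zero (show countSide base 2 s f ≠ 0 by omega)
    exact hasOption_arm hA (d := 1) (Or.inl rfl) (by omega) (by split_ifs <;> omega)
      (by split_ifs <;> omega)
  rcases h1 : countSide base 1 s f with _ | _ | a <;> rcases h2 : countSide base 2 s f with _ | b
  -- All arms have length divisible by 3 and one is nonempty. Shortening it by 1 or 2 gives the
  -- counts `(0, 1)` and `(1, 0)`, of classes `c0` and `c2s`.
  · push Not at hne
    obtain ⟨i, rfl, hi⟩ := hne
    have m1 := mod_ne_of_countSide_eq_zero h1 (i := i) rfl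
    have m2 := mod_ne_of_countSide_eq_zero h2 (i := i) rfl
    have o1 : HasOption base D f (base i) (ofCounts 0 1) :=
      hasOption_arm hA (d := 1) (Or.inl rfl) (by omega) (by split_ifs <;> omega)
        (by split_ifs <;> omega)
    have o2 : HasOption base D f (base i) (ofCounts 1 0) :=
      hasOption_arm hA (d := 2) (Or.inr rfl) (by omega) (by split_ifs <;> omega)
        (by split_ifs <;> omega)
    intro l hl
    have : ofCounts 0 1 ∈ l ∨ ofCounts 1 0 ∈ l := by
      revert l; decide
    rcases this with h | h
    · exact ⟨_, h, o1⟩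
    · exact ⟨_, h, o2⟩
  · rw [h1] at two two'
    intro l hl
    rcases exists_required_zero_succ b l hl with h | h
    · exact ⟨_, h, two b h2⟩
    · exact ⟨_, h, two' b h2⟩
  · have o1 := one 0 h1
    rw [h2] at o1
    -- The counts are `(1, 0)`. Class `c0` arises by deleting a side of two vertices, by taking 2
    -- from another arm (of length divisible by 3, giving `(2, 0)`), or by taking 2 from the arm of
    -- residue 1 if its length is at least 4, giving `(0, 1)`.
    have o0 : HasOption base D f s c0 := by
      obtain ⟨i, rfl, hi⟩ := exists_of_countSide_ne_zero (show countSide base 1 s f ≠ 0 by omega)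
      by_cases hR : Removable base (base i) f
      · exact hasOption_side hA hs hR
      by_cases h4 : f i = 1
      · have : ∃ k, k ≠ i ∧ base k = base i ∧ f k ≠ 0 := by
          by_contra! hcon
          exact hR (Or.inr ⟨i, rfl, h4, hcon⟩)
        obtain ⟨k, hki, hk, hk0⟩ := this
        have hz : countSide base 1 (base i) (Function.update f i 0) = 0 := by
          have := countSide_update_zero (base := base) (f := f) one_ne_zero i
          rw [h1, if_pos hi] at this
          omega
        have m1 := mod_ne_of_countSide_eq_zero hz hk
        rw [Function.update_of_ne hki] at m1
        have m2 := mod_ne_of_countSide_eq_zero h2 hk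
        rw [← hk] at h1 h2 ⊢
        exact hasOption_arm hA (i := k) (d := 2) (a := 2) (b := 0) (Or.inr rfl) (by omega)
          (by split_ifs <;> omega) (by split_ifs <;> omega)
      · exact hasOption_arm hA (d := 2) (a := 0) (b := 1) (Or.inr rfl) (by omega)
          (by split_ifs <;> omega) (by split_ifs <;> omega)
    intro l hl
    have : c0 ∈ l ∨ ofCounts 0 0 ∈ l := by
      revert l; decide
    rcases this with h | h
    · exact ⟨_, h, o0⟩
    · exact ⟨_, h, o1⟩
  · rw [h1] at two two'
    rw [h2] at one
    intro l hl
    rcases exists_required_succ_succ 0 b l hl with h | h | h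
    · exact ⟨_, h, one 0 h1⟩
    · exact ⟨_, h, two b h2⟩
    · exact ⟨_, h, two' b h2⟩
  · rw [h2] at one
    intro l hl
    exact ⟨_, exists_required_succ_zero a l hl, one _ h1⟩
  · rw [h1] at two two'
    rw [h2] at one
    intro l hl
    rcases exists_required_succ_succ (a + 1) b l hl with h | h | h
    · exact ⟨_, h, one _ h1⟩
    · exact ⟨_, h, two b h2⟩
    · exact ⟨_, h, two' b h2⟩

theorem grundy_empty {V : Type} [DecidableEq V] (G : SimpleGraph V) :
    (octalGame code033 G).grundy ∅ = 0 := by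
  apply ImpartialGame.grundy_eq_of_mex
  · intro B hB
    have h := ((opt_iff_of_cutConnected (CutConnected.empty G) B).1 hB).1.card
    simp at h
  · simp

/-- The Grundy value of a bistar is determined by the classes of its two stars. -/
theorem grundy_position (hA : Attached base D f) :
    (octalGame code033 (bispider base)).grundy (position D f) = positionValue base D f := by
  induction hn : (position D f).card using Nat.strong_induction_on generalizing D f with
  | _ n ih =>
  subst hn
  have hconn := cutConnected_position hA
  rcases D.eq_empty_or_nonempty with rfl | hD
  · have h0 : ∀ i, f i = 0 := fun i => by
      by_contra hi
      simpa using hA i (by omega)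
    have : position ∅ f = ∅ := by
      rw [← Finset.card_eq_zero, card_position, Finset.sum_eq_zero fun i _ => h0 i]
      rfl
    rw [this, grundy_empty]
    simp only [positionValue, sideClass, Finset.notMem_empty, if_false]
    rfl
  have key : ∀ D' f', Attached base D' f' →
      RemovesOneOrTwo (bispider base) (position D f) (position D' f') →
      (octalGame code033 (bispider base)).grundy (position D' f') = positionValue base D' f' := by
    intro D' f' hA' hR
    refine ih _ ?_ hA' rfl
    rcases hR.card with h | h <;> omega
  apply ImpartialGame.grundy_eq_of_mex
  · intro B hB
    rw [opt_iff_of_cutConnected hconn] at hB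
    obtain ⟨hR, hB⟩ := hB
    by_cases hc : ∀ s ∈ D, .inl s ∈ B
    · obtain ⟨i, d, hd, hdi, rfl⟩ := exists_arm_of_removes hR hB hD hc
      rw [key _ _ (hA.update i d) hR, positionValue_eq (base i),
        positionValue_eq (D := D) (f := f) (base i), sideClass_update_of_ne (s := !base i) (by simp)]
      exact ((separated_sideClass_update (hA i (by omega)) hd hdi) _).symm
    · push Not at hc
      obtain ⟨s, hs, hsB⟩ := hc
      by_cases ht : ∃ t, .inl t ∈ B
      · obtain ⟨t, ht⟩ := ht
        obtain ⟨hrem, rfl⟩ := removable_of_removes hR hB hs hsB ht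
        rw [key _ _ (hA.clearSide s) hR, positionValue_eq s,
          positionValue_eq (D := D) (f := f) s, sideClass_clearSide_self,
          sideClass_clearSide_of_ne (by simp)]
        have h1 : Separated c0 c1s := by decide
        have h2 : Separated c0 c2s := by decide
        rcases sideClass_of_removable hs hrem with h | h <;> rw [h]
        · exact h1 _
        · exact h2 _
      · push Not at ht
        -- Both the position and the option are paths, and their orders differ by 1 or 2, hence
        -- modulo 3.
        rw [positionValue_eq_card_of_removes hA hD hR hB ht]
        have : (octalGame code033 (bispider base)).grundy B = B.card % 3 := by
          rcases hB.exists_leg ht with rfl | ⟨i, hi⟩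
          · rw [grundy_empty]
            rfl
          · exact grundy_leg hB hi
        rw [this]
        rcases hR.card with h | h <;> omega
  · intro n hn
    have opt : ∀ s c, HasOption base D f s c → pairValue c (sideClass base D f (!s)) = n →
        ∃ B, (octalGame code033 (bispider base)).Opt (position D f) B ∧
          (octalGame code033 (bispider base)).grundy B = n := by
      rintro s c ⟨D', f', hA', hR, h1, h2⟩ hv
      refine ⟨_, (opt_iff_of_cutConnected hconn _).2 ⟨hR, cutConnected_position hA'⟩, ?_⟩
      rw [key _ _ hA' hR, positionValue_eq s, h1, h2, hv]
    -- The bad case is a side reduced to its centre, for which `exists_hasOption` is unavailable.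
    by_cases hbad : ∃ s ∈ D, ∀ i, base i = s → f i = 0
    · obtain ⟨s, hs, hz⟩ := hbad
      have hside := hasOption_side hA hs (Or.inl hz)
      have hcs := sideClass_eq_c1s hs hz
      rw [positionValue_eq s, hcs] at hn
      by_cases hother : (!s) ∈ D ∧ ∀ i, base i = (!s) → f i = 0
      · obtain ⟨ht, hz'⟩ := hother
        have hct := sideClass_eq_c1s ht hz'
        -- Two bare centres form a path with two vertices, of value 2; removing both or one of them
        -- gives 0 and 1.
        have hn2 : n = 0 ∨ n = 1 := by
          rw [hct] at hn
          change n < 2 at hn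
          omega
        rcases hn2 with rfl | rfl
        · refine ⟨∅, (opt_iff_of_cutConnected hconn _).2 ⟨Or.inr ⟨.inl s, by simpa using hs,
            .inl (!s), by simpa using ht, by simp, ?_⟩, CutConnected.empty _⟩, grundy_empty _⟩
          ext (r | ⟨i, j⟩)
          · cases s <;> cases r <;> simp
          · have : f i = 0 := by
              by_cases hi : base i = s
              · exact hz i hi
              · exact hz' i (Bool.eq_not.2 hi)
            simp [this]
        · refine opt s c0 hside ?_
          rw [hct]
          rfl
      · have hgood : ∀ l ∈ required (sideClass base D f (!s)),
            ∃ c ∈ l, HasOption base D f (!s) c := by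
          by_cases ht : (!s) ∈ D
          · exact exists_hasOption hA ht fun h => hother ⟨ht, h⟩
          -- An absent side has class `c0`, for which nothing is required.
          · simp [sideClass, ht, required]
        rcases exists_required_of_lt_c1s _ n hn with h | ⟨l, hl, h⟩
        · exact opt s c0 hside h
        · obtain ⟨c, hc, ho⟩ := hgood l hl
          refine opt (!s) c ho ?_
          rw [Bool.not_not, hcs, pairValue_comm]
          exact h c hc
    · have hgood : ∀ s, ∀ l ∈ required (sideClass base D f s),
            ∃ c ∈ l, HasOption base D f s c := by
        intro s
        by_cases hs : s ∈ D
        · exact exists_hasOption hA hs fun h => hbad ⟨s, hs, h⟩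
        · simp [sideClass, hs, required]
      rcases exists_required_of_lt _ _ n hn with ⟨l, hl, h⟩ | ⟨l, hl, h⟩
      · obtain ⟨c, hc, ho⟩ := hgood _ l hl
        exact opt true c ho (h c hc)
      · obtain ⟨c, hc, ho⟩ := hgood _ l hl
        refine opt false c ho ?_
        rw [pairValue_comm]
        exact h c hc

end PositionValue

open StarClass

namespace SubdividedStar

/-! ### Subdivided stars as positions -/

/-- The multiset of path lengths, which is empty for the empty graph. -/
def arms : SubdividedStar → Multiset ℕ+
  | empty => 0
  | star m => m

/-- The star has a central vertex. -/
def HasCenter : SubdividedStar → Prop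
  | empty => False
  | star _ => True

instance : DecidablePred HasCenter
  | empty => inferInstanceAs (Decidable False)
  | star _ => inferInstanceAs (Decidable True)

/-- The indices of the paths of a star. -/
abbrev ArmIndex (S : SubdividedStar) : Type := S.arms.toEnumFinset

instance (S S' : SubdividedStar) : DecidableEq (S.ArmIndex ⊕ S'.ArmIndex) :=
  instDecidableEqSum

/-- The coordinates of a vertex: its path and its distance from the start of the path. -/
def label : (S : SubdividedStar) → S.Vertex → Option (S.ArmIndex × ℕ)
  | empty => fun v => v.elim
  | star _ => Option.map fun p => (p.1, p.2.val)

theorem label_injective (S : SubdividedStar) : Function.Injective S.label := by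
  cases S with
  | empty => exact fun v => v.elim
  | star m =>
    refine Option.map_injective ?_
    rintro ⟨p, j⟩ ⟨q, l⟩ h
    obtain rfl : p = q := congrArg Prod.fst h
    have hjl : j.val = l.val := congrArg Prod.snd h
    rw [Fin.ext hjl]

theorem isCenter_iff (S : SubdividedStar) (v : S.Vertex) : S.IsCenter v ↔ S.label v = none := by
  cases S with
  | empty => exact v.elim
  | star m => exact Option.map_eq_none_iff.symm

theorem exists_label_eq_none (S : SubdividedStar) : (∃ v, S.label v = none) ↔ S.HasCenter := by
  cases S with
  | empty => exact ⟨fun ⟨v, _⟩ => v.elim, False.elim⟩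
  | star m => exact ⟨fun _ => trivial, fun _ => ⟨none, rfl⟩⟩

theorem exists_label_eq_some (S : SubdividedStar) (p : S.ArmIndex) (j : ℕ) :
    (∃ v, S.label v = some (p, j)) ↔ j < p.1.1 := by
  cases S with
  | empty => exact absurd p.2 (by simp [arms])
  | star m =>
    constructor
    · rintro ⟨v, hv⟩
      obtain ⟨⟨q, l⟩, rfl, h⟩ := Option.map_eq_some_iff.1 hv
      obtain ⟨rfl, rfl⟩ := Prod.mk.inj h
      exact l.2
    · intro h
      exact ⟨some ⟨p, ⟨j, h⟩⟩, rfl⟩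

theorem adj_of_label_none {S : SubdividedStar} {u v : S.Vertex} (hu : S.label u = none) :
    S.graph.Adj u v ↔ ∃ p, S.label v = some (p, 0) := by
  cases S with
  | empty => exact u.elim
  | star m =>
    obtain rfl : u = none := Option.map_eq_none_iff.1 hu
    simp only [graph, spider, SimpleGraph.fromRel_adj]
    constructor
    · rintro ⟨_, h | h⟩
      · cases h with
        | first i j hj => exact ⟨i, by simp [label, hj]⟩
      · cases h
    · rintro ⟨p, hp⟩
      obtain ⟨⟨q, l⟩, rfl, h⟩ := Option.map_eq_some_iff.1 hp
      exact ⟨by simp, Or.inl (SpiderEdge.first (len := fun p : m.toEnumFinset => p.1.1) q l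
        (congrArg Prod.snd h))⟩

theorem adj_of_label_some {S : SubdividedStar} {u v : S.Vertex} {p q : S.ArmIndex} {j l : ℕ}
    (hu : S.label u = some (p, j)) (hv : S.label v = some (q, l)) :
    S.graph.Adj u v ↔ p = q ∧ (j + 1 = l ∨ l + 1 = j) := by
  cases S with
  | empty => exact u.elim
  | star m =>
    obtain ⟨⟨p', j'⟩, rfl, h⟩ := Option.map_eq_some_iff.1 hu
    obtain ⟨rfl, rfl⟩ := Prod.mk.inj h
    obtain ⟨⟨q', l'⟩, rfl, h⟩ := Option.map_eq_some_iff.1 hv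
    obtain ⟨rfl, rfl⟩ := Prod.mk.inj h
    simp only [graph, spider, SimpleGraph.fromRel_adj]
    constructor
    · rintro ⟨_, h | h⟩
      · cases h with
        | next i j k hjk => exact ⟨rfl, Or.inl hjk.symm⟩
      · cases h with
        | next i j k hjk => exact ⟨rfl, Or.inr hjk.symm⟩
    · rintro ⟨h, hjl⟩
      subst h
      refine ⟨?_, ?_⟩
      · intro h
        simp only [Option.some.injEq, Sigma.mk.injEq, heq_eq_eq, true_and] at h
        subst h
        omega
      · rcases hjl with h | h
        · exact Or.inl (SpiderEdge.next _ _ _ h.symm)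
        · exact Or.inr (SpiderEdge.next _ _ _ h.symm)

variable (S S' : SubdividedStar)

/-- The centre at which a path of the bistar is attached. -/
def armBase : S.ArmIndex ⊕ S'.ArmIndex → Bool := Sum.elim (fun _ => true) fun _ => false

/-- The lengths of the paths of the bistar. -/
def armLength : S.ArmIndex ⊕ S'.ArmIndex → ℕ := Sum.elim (fun p => p.1.1) fun p => p.1.1

/-- The centres of the bistar. -/
def centers : Finset Bool :=
  Finset.univ.filter fun s => if s then S.HasCenter else S'.HasCenter

/-- The bistar as a subset of the infinite bispider. -/
def bistarMap : S.Vertex ⊕ S'.Vertex → Bool ⊕ (Σ _ : S.ArmIndex ⊕ S'.ArmIndex, ℕ) :=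
  Sum.elim
    (fun v => (S.label v).elim (.inl true) fun p => .inr ⟨.inl p.1, p.2⟩)
    (fun v => (S'.label v).elim (.inl false) fun p => .inr ⟨.inr p.1, p.2⟩)

theorem bistarMap_injective : Function.Injective (bistarMap S S') := by
  rintro (u | u) (v | v) h
  · refine congrArg _ (S.label_injective ?_)
    rcases hu : S.label u with _ | ⟨p, j⟩ <;> rcases hv : S.label v with _ | ⟨q, l⟩ <;>
      simp [bistarMap, hu, hv] at h ⊢
    exact h
  · rcases hu : S.label u with _ | ⟨p, j⟩ <;> rcases hv : S'.label v with _ | ⟨q, l⟩ <;>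
      simp [bistarMap, hu, hv] at h
  · rcases hu : S'.label u with _ | ⟨p, j⟩ <;> rcases hv : S.label v with _ | ⟨q, l⟩ <;>
      simp [bistarMap, hu, hv] at h
  · refine congrArg _ (S'.label_injective ?_)
    rcases hu : S'.label u with _ | ⟨p, j⟩ <;> rcases hv : S'.label v with _ | ⟨q, l⟩ <;>
      simp [bistarMap, hu, hv] at h ⊢
    exact h

theorem bistar_adj_inl_inl (u v : S.Vertex) :
    (bistar S S').Adj (.inl u) (.inl v) ↔ S.graph.Adj u v := by
  simp [bistar, SimpleGraph.fromRel_adj]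

theorem bistar_adj_inr_inr (u v : S'.Vertex) :
    (bistar S S').Adj (.inr u) (.inr v) ↔ S'.graph.Adj u v := by
  simp [bistar, SimpleGraph.fromRel_adj]

theorem bistar_adj_inl_inr (u : S.Vertex) (v : S'.Vertex) :
    (bistar S S').Adj (.inl u) (.inr v) ↔ S.label u = none ∧ S'.label v = none := by
  simp [bistar, SimpleGraph.fromRel_adj, isCenter_iff]

theorem bistarMap_adj (x y : S.Vertex ⊕ S'.Vertex) :
    (bispider (armBase S S')).Adj (bistarMap S S' x) (bistarMap S S' y) ↔
      (bistar S S').Adj x y := by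
  have cross : ∀ u v, (bispider (armBase S S')).Adj (bistarMap S S' (.inl u))
      (bistarMap S S' (.inr v)) ↔ (bistar S S').Adj (.inl u) (.inr v) := by
    intro u v
    rw [bistar_adj_inl_inr]
    rcases hu : S.label u with _ | ⟨p, j⟩ <;> rcases hv : S'.label v with _ | ⟨q, l⟩ <;>
      simp [bistarMap, hu, hv, armBase]
  rcases x with u | u <;> rcases y with v | v
  · rw [bistar_adj_inl_inl]
    rcases hu : S.label u with _ | ⟨p, j⟩ <;> rcases hv : S.label v with _ | ⟨q, l⟩
    · rw [adj_of_label_none hu]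
      simp [bistarMap, hu, hv]
    · rw [adj_of_label_none hu]
      simp [bistarMap, hu, hv, armBase]
    · rw [SimpleGraph.adj_comm S.graph, adj_of_label_none hv]
      simp [bistarMap, hu, hv, armBase]
    · rw [adj_of_label_some hu hv]
      simp [bistarMap, hu, hv]
  · exact cross u v
  · rw [SimpleGraph.adj_comm, cross, SimpleGraph.adj_comm]
  · rw [bistar_adj_inr_inr]
    rcases hu : S'.label u with _ | ⟨p, j⟩ <;> rcases hv : S'.label v with _ | ⟨q, l⟩
    · rw [adj_of_label_none hu]
      simp [bistarMap, hu, hv]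
    · rw [adj_of_label_none hu]
      simp [bistarMap, hu, hv, armBase]
    · rw [SimpleGraph.adj_comm S'.graph, adj_of_label_none hv]
      simp [bistarMap, hu, hv, armBase]
    · rw [adj_of_label_some hu hv]
      simp [bistarMap, hu, hv]

theorem image_bistarMap :
    Finset.univ.image (bistarMap S S') = position (centers S S') (armLength S S') := by
  have hl : ∀ v y, bistarMap S S' (.inl v) = y ↔
      (S.label v = none ∧ .inl true = y) ∨ ∃ p j, S.label v = some (p, j) ∧
        .inr ⟨.inl p, j⟩ = y := by
    intro v y
    rcases hv : S.label v with _ | ⟨p, j⟩ <;> simp [bistarMap, hv]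
  have hr : ∀ v y, bistarMap S S' (.inr v) = y ↔
      (S'.label v = none ∧ .inl false = y) ∨ ∃ p j, S'.label v = some (p, j) ∧
        .inr ⟨.inr p, j⟩ = y := by
    intro v y
    rcases hv : S'.label v with _ | ⟨p, j⟩ <;> simp [bistarMap, hv]
  ext (s | ⟨p | p, j⟩)
  · cases s
    · simp [hl, hr, centers, exists_label_eq_none]
    · simp [hl, hr, centers, exists_label_eq_none]
  · rw [inr_mem_position, armLength, Sum.elim_inl, ← exists_label_eq_some]
    simp [hl, hr]
  · rw [inr_mem_position, armLength, Sum.elim_inr, ← exists_label_eq_some]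
    simp [hl, hr]

theorem hasCenter_of_armIndex (p : S.ArmIndex) : S.HasCenter := by
  cases S with
  | empty => exact absurd p.2 (by simp [arms])
  | star m => trivial

theorem attached_armLength :
    Attached (armBase S S') (centers S S') (armLength S S') := by
  rintro (p | p) _
  · simpa [armBase, centers] using hasCenter_of_armIndex S p
  · simpa [armBase, centers] using hasCenter_of_armIndex S' p

/-- The number of paths of length `r` modulo 3. -/
def armCount (r : ℕ) (S : SubdividedStar) : ℕ := S.arms.countP fun l : ℕ+ => (l : ℕ) % 3 = r

/-- Arms are indexed by pairs of a length and a copy number, so summing over indices counts lengths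
with multiplicity. -/
theorem sum_armIndex (r : ℕ) :
    (∑ p : S.ArmIndex, if (p.1.1 : ℕ) % 3 = r then 1 else 0) = S.armCount r := by
  have h : ∀ m : Multiset ℕ+, (m.map fun l : ℕ+ => if (l : ℕ) % 3 = r then 1 else 0).sum =
      m.countP fun l : ℕ+ => (l : ℕ) % 3 = r := by
    intro m
    induction m using Multiset.induction with
    | empty => simp
    | cons a m ih => simp [Multiset.countP_cons, ih, add_comm]
  rw [armCount, ← h, Finset.sum_coe_sort S.arms.toEnumFinset
    (fun p => if (p.1 : ℕ) % 3 = r then 1 else 0)]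
  conv_rhs => rw [← Multiset.map_toEnumFinset_fst S.arms, Multiset.map_map]
  rfl

/-- The name of the class of a star. -/
def starClass : SubdividedStar → StarClass
  | empty => c0
  | star m => ofCounts ((star m).armCount 1) ((star m).armCount 2)

theorem starClass_eq :
    S.starClass = if S.HasCenter then ofCounts (S.armCount 1) (S.armCount 2) else c0 := by
  cases S <;> simp [starClass, HasCenter]

theorem sideClass_true :
    sideClass (armBase S S') (centers S S') (armLength S S') true = S.starClass := by
  simp [sideClass, starClass_eq, centers, countSide, armBase, armLength, sum_armIndex,
    -Finset.sum_boole, -Finset.univ_eq_attach]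

theorem sideClass_false :
    sideClass (armBase S S') (centers S S') (armLength S S') false = S'.starClass := by
  simp [sideClass, starClass_eq, centers, countSide, armBase, armLength, sum_armIndex,
    -Finset.sum_boole, -Finset.univ_eq_attach]

theorem cutConnected_bistar : CutConnected (bistar S S') Finset.univ := by
  rw [← CutConnected.image_iff (bistarMap_injective S S').injOn
    (fun x _ y _ => bistarMap_adj S S' x y), image_bistarMap]
  exact cutConnected_position (attached_armLength S S')

theorem grundy_bistar :
    grundy033 (bistar S S') = pairValue S.starClass S'.starClass := by
  rw [grundy033, ← grundy_image (cutConnected_bistar S S') (bistarMap_injective S S').injOn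
    (fun x _ y _ => bistarMap_adj S S' x y), image_bistarMap,
    grundy_position (attached_armLength S S'), positionValue, sideClass_true, sideClass_false]

/-- A star is its bistar with the empty graph, whose class is `c0`. -/
theorem grundy_eq_value : S.grundy = S.starClass.value := by
  have himage : Finset.univ.image (Sum.inl : S.Vertex → S.Vertex ⊕ empty.Vertex) =
      Finset.univ := by
    ext (v | v)
    · simp
    · exact v.elim
  have hadj : ∀ u ∈ Finset.univ, ∀ v ∈ Finset.univ,
      (bistar S empty).Adj (.inl u) (.inl v) ↔ S.graph.Adj u v :=
    fun u _ v _ => bistar_adj_inl_inl S empty u v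
  have hconn : CutConnected S.graph Finset.univ := by
    rw [← CutConnected.image_iff Sum.inl_injective.injOn hadj, himage]
    exact cutConnected_bistar S empty
  rw [grundy, grundy033, ← grundy_image hconn Sum.inl_injective.injOn hadj, himage, ← pairValue_c0]
  exact grundy_bistar S empty

theorem sim1_iff : Sim1 S S' ↔ ∀ T : SubdividedStar,
    pairValue S.starClass T.starClass = pairValue S'.starClass T.starClass := by
  refine forall_congr' fun T => ?_
  rw [Equivalent033, ImpartialGame.equivalent_iff]
  change grundy033 (bistar S T) = grundy033 (bistar S' T) ↔ _
  rw [grundy_bistar, grundy_bistar]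

/-! ### Reduced stars -/

/-- The star with `a` paths of length 1 and `b` paths of length 2. -/
def reducedStar (a b : ℕ) : SubdividedStar :=
  star (Multiset.replicate a 1 + Multiset.replicate b 2)

theorem reducedStar_inj {a b a' b' : ℕ} :
    reducedStar a b = reducedStar a' b' ↔ a = a' ∧ b = b' := by
  refine ⟨fun h => ?_, fun h => by rw [h.1, h.2]⟩
  have h' := SubdividedStar.star.inj h
  have h1 := congrArg (Multiset.count 1) h'
  have h2 := congrArg (Multiset.count 2) h'
  simp [Multiset.count_replicate] at h1 h2
  exact ⟨h1, h2⟩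

theorem twos_reducedStar (a b : ℕ) : (reducedStar a b).twos = b := by
  simp [reducedStar, twos, Multiset.count_replicate]

theorem reduce_star (m : Multiset ℕ+) :
    (star m).reduce = reducedStar ((star m).armCount 1) ((star m).armCount 2) := by
  simp only [reduce, reducedStar, armCount, arms, Multiset.pure_def, Multiset.bind_def,
    Multiset.bind_singleton, star.injEq]
  induction m using Multiset.induction with
  | empty => simp
  | cons l m ih =>
    have hmod : (l : ℕ) % 3 = 0 ∨ (l : ℕ) % 3 = 1 ∨ (l : ℕ) % 3 = 2 := by omega
    rw [Multiset.map_cons]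
    rcases hmod with h | h | h
    · rw [Multiset.filterMap_cons_none _ _ (by simp [h]), ih]
      simp [h]
    · rw [Multiset.filterMap_cons_some (b := 1) _ _ _ (by simp [h]), ih]
      simp [h, Multiset.replicate_succ]
    · rw [Multiset.filterMap_cons_some (b := 2) _ _ _ (by simp [h]), ih]
      simp [h, Multiset.replicate_succ]

theorem starClass_reducedStar (a b : ℕ) : (reducedStar a b).starClass = ofCounts a b := by
  have h : ∀ (r n : ℕ) (x : ℕ+), ((Multiset.replicate n x).countP fun l : ℕ+ => (l : ℕ) % 3 = r) =
      if (x : ℕ) % 3 = r then n else 0 := by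
    intro r n x
    split_ifs with hx
    · rw [Multiset.countP_eq_card.2, Multiset.card_replicate]
      intro y hy
      rwa [Multiset.eq_of_mem_replicate hy]
    · rw [Multiset.countP_eq_zero]
      intro y hy
      rwa [Multiset.eq_of_mem_replicate hy]
  simp [reducedStar, starClass, armCount, arms, h]

/-- The witnesses are entries of the table `ofCap`. That every class occurs lets stars test all
columns of `pairValue` and makes the eight sets nonempty. -/
theorem starClass_surjective : Function.Surjective starClass := by
  intro c
  cases c
  · exact ⟨empty, rfl⟩
  · exact ⟨reducedStar 3 0, starClass_reducedStar _ _⟩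
  · exact ⟨reducedStar 0 0, starClass_reducedStar _ _⟩
  · exact ⟨reducedStar 0 5, starClass_reducedStar _ _⟩
  · exact ⟨reducedStar 1 0, starClass_reducedStar _ _⟩
  · exact ⟨reducedStar 2 1, starClass_reducedStar _ _⟩
  · exact ⟨reducedStar 1 5, starClass_reducedStar _ _⟩
  · exact ⟨reducedStar 3 1, starClass_reducedStar _ _⟩

theorem sim1_iff_starClass_eq : Sim1 S S' ↔ S.starClass = S'.starClass := by
  rw [sim1_iff]
  refine ⟨fun h => pairValue_left_injective fun d => ?_, fun h T => by rw [h]⟩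
  obtain ⟨T, rfl⟩ := starClass_surjective d
  exact h T

end SubdividedStar

/-! ### The sets of the statement as fibres of the class map -/

namespace StarClass

open SubdividedStar

/-- Capping loses nothing on the small counts: at most one arm of residue 1 here, at most three of
residue 2 in `capTwo_eq`. The definitions of the starred and box sets test only such counts, so
membership becomes a condition on capped counts. -/
theorem capOne_eq (a : ℕ) :
    (capOne a = 0 ↔ a = 0) ∧ (capOne a = 1 ↔ a = 1) := by
  have h2 : ∀ n, capOne (n + 2) = 2 ∨ capOne (n + 2) = 3 := by
    intro n
    rw [capOne, capOne]
    generalize capOne n = x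
    revert x; decide
  rcases a with _ | _ | n
  · decide
  · decide
  · rcases h2 n with h | h <;> rw [h] <;> simp

theorem capTwo_eq (b : ℕ) : (capTwo b = 0 ↔ b = 0) ∧ (capTwo b = 1 ↔ b = 1) ∧
    (capTwo b = 2 ↔ b = 2) ∧ (capTwo b = 3 ↔ b = 3) := by
  have h4 : ∀ n, capTwo (n + 4) = 4 ∨ capTwo (n + 4) = 5 := by
    intro n
    rw [capTwo, capTwo, capTwo, capTwo]
    generalize capTwo n = x
    revert x; decide
  rcases b with _ | _ | _ | _ | n
  · decide
  · decide
  · decide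
  · decide
  · rcases h4 n with h | h <;> rw [h] <;> simp

theorem star_mem_set1s (m : Multiset ℕ+) : star m ∈ set1s ↔
    (capOne ((star m).armCount 1) = 0 ∧ capTwo ((star m).armCount 2) = 0) ∨
    (capOne ((star m).armCount 1) = 1 ∧ capTwo ((star m).armCount 2) = 1) ∨
    (capOne ((star m).armCount 1) = 0 ∧ capTwo ((star m).armCount 2) = 3) := by
  have e1 : SubdividedStar.star 0 = reducedStar 0 0 := rfl
  have e2 : SubdividedStar.star {2, 1} = reducedStar 1 1 :=
    congrArg SubdividedStar.star (by decide)
  have e3 : SubdividedStar.star {2, 2, 2} = reducedStar 0 3 := rfl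
  rw [set1s, Set.mem_ofPred_eq, reduce_star, e1, e2, e3]
  simp only [Set.mem_insert_iff, Set.mem_singleton_iff, reducedStar_inj, capOne_eq, capTwo_eq]

theorem star_mem_set2s (m : Multiset ℕ+) : star m ∈ set2s ↔
    (capOne ((star m).armCount 1) = 1 ∧ capTwo ((star m).armCount 2) = 0) ∨
    (capOne ((star m).armCount 1) = 0 ∧ capTwo ((star m).armCount 2) = 2) := by
  have e1 : SubdividedStar.star {1} = reducedStar 1 0 := rfl
  have e2 : SubdividedStar.star {2, 2} = reducedStar 0 2 := rfl
  rw [set2s, Set.mem_ofPred_eq, reduce_star, e1, e2]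
  simp only [Set.mem_insert_iff, Set.mem_singleton_iff, reducedStar_inj, capOne_eq, capTwo_eq]

theorem star_mem_setBox (m : Multiset ℕ+) (i : ℕ) : star m ∈ setBox i ↔
    (ofCap (capOne ((star m).armCount 1)) (capTwo ((star m).armCount 2))).value = i ∧
    (capTwo ((star m).armCount 2) = 1 ∨ capTwo ((star m).armCount 2) = 3) := by
  rw [setBox, Set.mem_ofPred_eq, reduce_star, twos_reducedStar, grundy_eq_value]
  simp only [capTwo_eq]
  rfl

theorem star_mem_setPlain (m : Multiset ℕ+) (i : ℕ) : star m ∈ setPlain i ↔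
    (ofCap (capOne ((star m).armCount 1)) (capTwo ((star m).armCount 2))).value = i ∧
    star m ∉ set1s ∧ star m ∉ set2s ∧ star m ∉ setBox 2 ∧ star m ∉ setBox 3 := by
  rw [setPlain, Set.mem_ofPred_eq, grundy_eq_value]
  rfl

/-- The sets of the statement are the fibres of `SubdividedStar.starClass`. -/
theorem mem_toSet (c : StarClass) (S : SubdividedStar) : S ∈ c.toSet ↔ S.starClass = c := by
  cases S with
  | empty =>
    have hg : SubdividedStar.empty.grundy = 0 := grundy_eq_value .empty
    cases c <;>
      simp [toSet, set1s, set2s, setBox, setPlain, reduce, twos, hg, starClass]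
  | star m =>
    rw [starClass, ofCounts]
    cases c <;> simp only [toSet, star_mem_setPlain, star_mem_set1s, star_mem_set2s,
        star_mem_setBox] <;>
      -- Both sides depend only on the capped counts, so for each class 24 cases remain.
      generalize capOne _ = x <;> generalize capTwo _ = y <;> revert x y <;> decide

theorem toSet_injective : Function.Injective toSet := by
  intro c c' h
  obtain ⟨S, rfl⟩ := starClass_surjective c
  have hS : S ∈ toSet S.starClass := (mem_toSet _ _).2 rfl
  rw [h, mem_toSet] at hS
  exact hS

end StarClass

/-! ### The equivalence relation, its classes and the final table -/

theorem SubdividedStar.equivalence_sim1 : Equivalence SubdividedStar.Sim1 where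
  refl S := (sim1_iff_starClass_eq S S).2 rfl
  symm h := (sim1_iff_starClass_eq _ _).2 ((sim1_iff_starClass_eq _ _).1 h).symm
  trans h h' := (sim1_iff_starClass_eq _ _).2
    (((sim1_iff_starClass_eq _ _).1 h).trans ((sim1_iff_starClass_eq _ _).1 h'))

theorem SubdividedStar.classes_sim1 :
    Setoid.classes ⟨SubdividedStar.Sim1, SubdividedStar.equivalence_sim1⟩ =
      Set.range StarClass.toSet := by
  have h : ∀ T : SubdividedStar, {S | SubdividedStar.Sim1 S T} = T.starClass.toSet := by
    intro T
    ext S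
    rw [Set.mem_ofPred_eq, sim1_iff_starClass_eq, StarClass.mem_toSet]
  ext X
  constructor
  · rintro ⟨T, rfl⟩
    exact ⟨T.starClass, (h T).symm⟩
  · rintro ⟨c, rfl⟩
    obtain ⟨T, rfl⟩ := SubdividedStar.starClass_surjective c
    exact ⟨T, (h T).symm⟩

theorem mainTheorem4 :
    (∃ h : Equivalence SubdividedStar.Sim1,
      Setoid.classes ⟨SubdividedStar.Sim1, h⟩ = Set.range StarClass.toSet) ∧
    Function.Injective StarClass.toSet ∧
    ∀ (c c' : StarClass), ∀ S ∈ c.toSet, ∀ S' ∈ c'.toSet,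
      grundy033 (SubdividedStar.bistar S S') =
        (StarClass.table c c').getD (S.grundy ^^^ S'.grundy) := by
  refine ⟨⟨SubdividedStar.equivalence_sim1, SubdividedStar.classes_sim1⟩,
    StarClass.toSet_injective, ?_⟩
  intro c c' S hS S' hS'
  rw [StarClass.mem_toSet] at hS hS'
  subst hS hS'
  rw [SubdividedStar.grundy_bistar, SubdividedStar.grundy_eq_value S,
    SubdividedStar.grundy_eq_value S', StarClass.pairValue]
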